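/- Let $(K,J,g_K)$ be a complex space form $K(v)$, that is, a Kähler manifold of constant holomorphic sectional curvature $v$, with Levi-Civita connection $\nabla$ and curvature $R(X,Y)Z=\nabla_X\nabla_YZ-\nabla_Y\nabla_XZ-\nabla_{[X,Y]}Z$, the sign being such that $g_K(R(X,JX)JX,X)=v\,g_K(X,X)^2$. Let $(L,g_L)$ be a Riemannian manifold and $F:K\to L$ a conformal pointwise slant Riemannian map with slant function $\theta$. This means that $F$ is smooth; that there is a positive function $\lambda$ on $K$ with $g_L(F_*X,F_*Y)=\lambda^2(p)\,g_K(X,Y)$ for all $p\in K$ and $X,Y\in(\ker F_{*p})^\perp$; and that for every $p\in K$ and every nonzero $X\in\ker F_{*p}$ the angle between $JX$ and the subspace $\ker F_{*p}$ equals $\theta(p)$. Assume that $(\operatorname{range}F_{*p})^\perp=\{0\}$ and $\dim\ker F_{*p}=2r$ for all $p\in K$. Let $\mathcal V$ and $\mathcal H$ be the orthogonal projections onto $\ker F_*$ and $(\ker F_*)^\perp$, and put $$T_DW=\mathcal H\nabla_{\mathcal VD}\mathcal VW+\mathcal V\nabla_{\mathcal VD}\mathcal HW,\qquad \hat\nabla_VW=\mathcal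 V\nabla_VW,$$ $$\hat R(U,V)W=\hat\nabla_U\hat\nabla_VW-\hat\nabla_V\hat\nabla_UW-\hat\nabla_{[U,V]}W\quad\text{for vertical } U,V,W,$$ $$\operatorname{Ric}^{\ker F_*}(U)=\sum_{i=1}^{2r}g_K(\hat R(U,E_i)E_i,U),\qquad H=\frac1{2r}\sum_{i=1}^{2r}T_{E_i}E_i,$$ where $E_1,\dots,E_{2r}$ are local vertical fields that are orthonormal at the point considered (and $H=0$ if $r=0$). Thus $\operatorname{Ric}^{\ker F_*}$ is the Ricci curvature, and $H$ the mean curvature vector field, of the fibers of $F$. Then for every $U\in\Gamma(\ker F_*)$, at every point of $K$, $$\operatorname{Ric}^{\ker F_*}(U)\le\frac v4\,(2r-1+3\cos^2\theta)\,g_K(U,U)+2r\,g_K(T_UU,H).$$ Equality holds for all $U\in\Gamma(\ker F_*)$ at all points of $K$ if and only if the fibers of $F$ are totally geodesic, that is, $\nabla_UV\in\Gamma(\ker F_*)$ for all $U,V\in\Gamma(\ker F_*)$. -/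

import Mathlib

open Bundle VectorField InnerProductGeometry
open scoped Manifold ContDiff RealInnerProductSpace

noncomputable section

namespace CPSRM

section Single

variable {E : Type*} [NormedAddCommGroup E] [NormedSpace ℝ E]
  {K : Type*} [TopologicalSpace K] [ChartedSpace E K]

/-- Every tangent space of a finite-dimensional manifold is finite-dimensional. -/
instance instFiniteDimensionalTangentSpace [FiniteDimensional ℝ E] (p : K) :
    FiniteDimensional ℝ (TangentSpace 𝓘(ℝ, E) p) :=
  inferInstanceAs (FiniteDimensional ℝ E)

/-- (Not necessarily smooth) vector fields on the manifold `K`. -/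
abbrev VField (E : Type*) [NormedAddCommGroup E] [NormedSpace ℝ E]
    (K : Type*) [TopologicalSpace K] [ChartedSpace E K] : Type _ :=
  ∀ p : K, TangentSpace 𝓘(ℝ, E) p

variable [IsManifold 𝓘(ℝ, E) ∞ K]

/-- Smooth vector fields, `X ∈ Γ(TK)`. -/
def IsSmooth (X : VField E K) : Prop :=
  ContMDiff 𝓘(ℝ, E) (𝓘(ℝ, E).prod 𝓘(ℝ, E)) ∞
    (fun p => (TotalSpace.mk' E p (X p) : TangentBundle 𝓘(ℝ, E) K))

variable [RiemannianBundle (fun p : K => TangentSpace 𝓘(ℝ, E) p)]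

/-- The derivative `X⟨Y, Z⟩` at `p` of the function `⟨Y, Z⟩` in the direction `X p`. -/
def derivInner (X Y Z : VField E K) (p : K) : ℝ :=
  mfderiv 𝓘(ℝ, E) 𝓘(ℝ, ℝ) (fun q : K => ⟪Y q, Z q⟫) p (X p)

/-- The Koszul expression: for the Levi-Civita connection `∇` and differentiable fields,
this is `⟨∇_X Y, Z⟩` at `p`. -/
def koszul (X Y Z : VField E K) (p : K) : ℝ :=
  (1 / 2) * (derivInner X Y Z p + derivInner Y Z X p - derivInner Z X Y p
    + ⟪mlieBracket 𝓘(ℝ, E) X Y p, Z p⟫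
    - ⟪mlieBracket 𝓘(ℝ, E) X Z p, Y p⟫
    - ⟪mlieBracket 𝓘(ℝ, E) Y Z p, X p⟫)

variable [FiniteDimensional ℝ E]

/-- The Levi-Civita connection `∇_X Y` of the Riemannian metric of `K`, defined by the Koszul
formula: the component of `(∇_X Y) p` along a vector `z` of an orthonormal basis of `T_p K` is the
Koszul expression of `X`, `Y` and a local extension of `z`. -/
def leviCivita (X Y : VField E K) : VField E K := fun p =>
  ∑ i, koszul X Y
      (FiberBundle.extend E (stdOrthonormalBasis ℝ (TangentSpace 𝓘(ℝ, E) p) i)) p •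
    stdOrthonormalBasis ℝ (TangentSpace 𝓘(ℝ, E) p) i

/-- The curvature `R(X, Y)Z = ∇_X ∇_Y Z - ∇_Y ∇_X Z - ∇_[X,Y] Z`. -/
def curvature (X Y Z : VField E K) : VField E K := fun p =>
  leviCivita X (leviCivita Y Z) p - leviCivita Y (leviCivita X Z) p
    - leviCivita (mlieBracket 𝓘(ℝ, E) X Y) Z p

/-- The vector field `J X`, for an endomorphism field `J`. -/
def applyField (J : ∀ p : K, TangentSpace 𝓘(ℝ, E) p →ₗ[ℝ] TangentSpace 𝓘(ℝ, E) p)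
    (X : VField E K) : VField E K := fun p => J p (X p)

/-- `(K, J, g)` is a Kähler manifold: `J` is a smooth almost complex structure, the metric is
Hermitian and `∇ J = 0`. -/
structure IsKahler (J : ∀ p : K, TangentSpace 𝓘(ℝ, E) p →ₗ[ℝ] TangentSpace 𝓘(ℝ, E) p) : Prop where
  smooth : ∀ X : VField E K, IsSmooth X → IsSmooth (applyField J X)
  sq : ∀ (p : K) (x : TangentSpace 𝓘(ℝ, E) p), J p (J p x) = -x
  hermitian : ∀ (p : K) (x y : TangentSpace 𝓘(ℝ, E) p), ⟪J p x, J p y⟫ = ⟪x, y⟫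
  parallel : ∀ X Y : VField E K, IsSmooth X → IsSmooth Y → ∀ p : K,
    leviCivita X (applyField J Y) p = J p (leviCivita X Y p)

/-- `(K, J, g)` is a complex space form `K(v)`: a Kähler manifold of constant holomorphic sectional
curvature `v`. -/
structure IsComplexSpaceForm
    (J : ∀ p : K, TangentSpace 𝓘(ℝ, E) p →ₗ[ℝ] TangentSpace 𝓘(ℝ, E) p) (v : ℝ) : Prop
    extends IsKahler J where
  holSectional : ∀ X : VField E K, IsSmooth X → ∀ p : K,
    ⟪curvature X (applyField J X) (applyField J X) p, X p⟫ = v * ⟪X p, X p⟫ ^ 2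

end Single

section Map

variable {E : Type*} [NormedAddCommGroup E] [NormedSpace ℝ E]
  {K : Type*} [TopologicalSpace K] [ChartedSpace E K]
  {E' : Type*} [NormedAddCommGroup E'] [NormedSpace ℝ E']
  {L : Type*} [TopologicalSpace L] [ChartedSpace E' L]

/-- The vertical space `ker F_{*p}`. -/
def vertical (F : K → L) (p : K) : Submodule ℝ (TangentSpace 𝓘(ℝ, E) p) :=
  LinearMap.ker (mfderiv 𝓘(ℝ, E) 𝓘(ℝ, E') F p).toLinearMap

/-- `range F_{*p}`, a subspace of the tangent space of `L` at `F p`. -/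
def rangeSpace (F : K → L) (p : K) : Submodule ℝ (TangentSpace 𝓘(ℝ, E') (F p)) :=
  LinearMap.range (mfderiv 𝓘(ℝ, E) 𝓘(ℝ, E') F p).toLinearMap

variable [FiniteDimensional ℝ E]
  [IsManifold 𝓘(ℝ, E) ∞ K] [RiemannianBundle (fun p : K => TangentSpace 𝓘(ℝ, E) p)]
  [IsManifold 𝓘(ℝ, E') ∞ L] [RiemannianBundle (fun q : L => TangentSpace 𝓘(ℝ, E') q)]

/-- Conformal Riemannian maps: smooth maps such that
`g_L(F_* x, F_* y) = λ² g_K(x, y)` for all `x, y ∈ (ker F_*)ᗮ`, for a positive function `λ`. -/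
structure IsConformalRiemannianMap (F : K → L) : Prop where
  smooth : ContMDiff 𝓘(ℝ, E) 𝓘(ℝ, E') ∞ F
  conformal : ∃ dil : K → ℝ, (∀ p, 0 < dil p) ∧
    ∀ p : K, ∀ x ∈ (vertical (E := E) (E' := E') F p)ᗮ,
      ∀ y ∈ (vertical (E := E) (E' := E') F p)ᗮ,
        ⟪mfderiv 𝓘(ℝ, E) 𝓘(ℝ, E') F p x, mfderiv 𝓘(ℝ, E) 𝓘(ℝ, E') F p y⟫
          = dil p ^ 2 * ⟪x, y⟫

/-- The angle between a nonzero vector `x` and a subspace `S`: the angle between `x` and its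
orthogonal projection to `S` (it is `π / 2` if that projection vanishes). -/
def angleToSubspace {V : Type*} [NormedAddCommGroup V] [InnerProductSpace ℝ V]
    [FiniteDimensional ℝ V] (x : V) (S : Submodule ℝ V) : ℝ :=
  angle x (S.starProjection x)

/-- `F` is a conformal pointwise slant Riemannian map with slant function `θ`: for nonzero
`x ∈ ker F_{*p}` the Wirtinger angle between `J x` and `ker F_{*p}` is `θ p`, independently of
`x`. -/
structure IsCPSRM (J : ∀ p : K, TangentSpace 𝓘(ℝ, E) p →ₗ[ℝ] TangentSpace 𝓘(ℝ, E) p)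
    (F : K → L) (θ : K → ℝ) : Prop
    extends IsConformalRiemannianMap (E := E) (E' := E') F where
  slant : ∀ p : K, ∀ x ∈ vertical (E := E) (E' := E') F p, x ≠ 0 →
    angleToSubspace (J p x) (vertical (E := E) (E' := E') F p) = θ p

/-- The vertical part `𝒱 X` of a vector field. -/
def vPart (F : K → L) (X : VField E K) : VField E K := fun p =>
  (vertical (E' := E') F p).starProjection (X p)

/-- The horizontal part `ℋ X` of a vector field. -/
def hPart (F : K → L) (X : VField E K) : VField E K := fun p =>
  (vertical (E' := E') F p)ᗮ.starProjection (X p)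

/-- Smooth vertical vector fields, `U ∈ Γ(ker F_*)`. -/
structure IsVertical (F : K → L) (U : VField E K) : Prop where
  smooth : IsSmooth U
  mem : ∀ p : K, U p ∈ vertical (E' := E') F p

/-- O'Neill's tensor `T_D W = ℋ ∇_{𝒱D} 𝒱W + 𝒱 ∇_{𝒱D} ℋW`. On vertical fields it is the second
fundamental form of the fibers. -/
def tensorT (F : K → L) (D W : VField E K) : VField E K := fun p =>
  hPart (E' := E') F (leviCivita (vPart (E' := E') F D) (vPart (E' := E') F W)) p
    + vPart (E' := E') F (leviCivita (vPart (E' := E') F D) (hPart (E' := E') F W)) p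

/-- The connection `∇̂_V W = 𝒱 ∇_V W` on `ker F_*`, that is, the Levi-Civita connection of the
fibers with their induced metrics. -/
def fiberConnection (F : K → L) (V W : VField E K) : VField E K :=
  vPart (E' := E') F (leviCivita V W)

/-- The curvature of `∇̂`, that is, the curvature of the fibers. -/
def fiberCurvature (F : K → L) (U V W : VField E K) : VField E K := fun p =>
  fiberConnection (E' := E') F U (fiberConnection (E' := E') F V W) p
    - fiberConnection (E' := E') F V (fiberConnection (E' := E') F U W) p
    - fiberConnection (E' := E') F (mlieBracket 𝓘(ℝ, E) U V) W p

/-- Vertical fields `E_i`, smooth near `p`, whose values at `p` form an orthonormal basis of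
`ker F_{*p}`. -/
def vFrame (F : K → L) (p : K)
    (i : Fin (Module.finrank ℝ (vertical (E := E) (E' := E') F p))) : VField E K :=
  vPart (E' := E') F (FiberBundle.extend E
    (stdOrthonormalBasis ℝ (vertical (E := E) (E' := E') F p) i : TangentSpace 𝓘(ℝ, E) p))

/-- The Ricci curvature of the fibers, `Ric(U) = ∑ i, g(R̂(U, E_i)E_i, U)`, at `p`. -/
def fiberRicci (F : K → L) (U : VField E K) (p : K) : ℝ :=
  ∑ i, ⟪fiberCurvature (E' := E') F U (vFrame (E' := E') F p i) (vFrame (E' := E') F p i) p, U p⟫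

/-- The mean curvature vector field of the fibers, `H = (1 / dim ker F_*) ∑ i, T_{E_i} E_i`. -/
def meanCurvature (F : K → L) : VField E K := fun p =>
  (Module.finrank ℝ (vertical (E := E) (E' := E') F p) : ℝ)⁻¹ •
    ∑ i, tensorT (E' := E') F (vFrame (E' := E') F p i) (vFrame (E' := E') F p i) p

/-- The fibers are totally geodesic: `∇_U V` is vertical for all vertical fields `U, V`. -/
def FibersTotallyGeodesic (F : K → L) : Prop :=
  ∀ U V : VField E K, IsVertical (E' := E') F U → IsVertical (E' := E') F V →
    ∀ p : K, leviCivita U V p ∈ vertical (E' := E') F p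

end Map

end CPSRM

end

/-! The inequality is the traced Gauss equation of the fibers with one nonnegative term dropped. The
map is a submersion, so the vertical distribution is smooth and involutive. Involutivity makes the
second fundamental form `T` of the fibers symmetric, and for vertical `U`, `V` the Gauss equation
(`inner_fiberCurvature`) reads g(R̂(U,V)V,U) = g(R(U,V)V,U) + g(T_U U,T_V V) - |T_U V|².

In a complex space form g(R(X,Y)Y,X) = v/4 (|X|²|Y|² - g(X,Y)² + 3 g(X,JY)²); this is
`IsComplexSpaceForm.inner_curvature`, obtained by polarizing the holomorphic sectional curvature.
Let V run over a frame E_i orthonormal at the point. Then ∑ g(U,E_i)² = |U|², while ∑ g(U,JE_i)² is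
the squared length of the vertical projection of JU, which the slant condition makes cos²θ |U|². The
terms g(T_U U,T_{E_i} E_i) add up to 2r g(T_U U,H). Hence (`fiberRicci_eq`) the right side of the
inequality exceeds the Ricci curvature by exactly ∑ |T_U E_i|².

The inequality follows at once. Equality for all U means T_U E_i = 0 for every frame field, and
since `T` is tensorial this says that ∇_U V is vertical for all vertical U, V.

The connection is given only by the Koszul formula, so its basic properties and the symmetries of
its curvature are derived from that formula. -/

namespace CPSRM

open scoped Topology

/-! ### Vector fields smooth at a point -/

section

variable {E : Type*} [NormedAddCommGroup E] [NormedSpace ℝ E]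
  {K : Type*} [TopologicalSpace K] [ChartedSpace E K] [IsManifold 𝓘(ℝ, E) ∞ K]

/-- The vector field `X` is smooth at the point `p`. -/
def SmoothAt (X : VField E K) (p : K) : Prop :=
  ContMDiffAt 𝓘(ℝ, E) (𝓘(ℝ, E).prod 𝓘(ℝ, E)) ∞
    (fun q => (TotalSpace.mk' E q (X q) : TangentBundle 𝓘(ℝ, E) K)) p

/-- The vector field `X` is differentiable at the point `p`. -/
abbrev DiffAt (X : VField E K) (p : K) : Prop :=
  MDifferentiableAt 𝓘(ℝ, E) (𝓘(ℝ, E).prod 𝓘(ℝ, E))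
    (fun q => (TotalSpace.mk' E q (X q) : TangentBundle 𝓘(ℝ, E) K)) p

theorem IsSmooth.smoothAt {X : VField E K} (h : IsSmooth X) (p : K) : SmoothAt X p := h p

theorem SmoothAt.diffAt {X : VField E K} {p : K} (h : SmoothAt X p) : DiffAt X p :=
  ContMDiffAt.mdifferentiableAt h (by simp)

theorem IsSmooth.diffAt {X : VField E K} (h : IsSmooth X) (p : K) : DiffAt X p :=
  (h.smoothAt p).diffAt

theorem SmoothAt.congr {X Y : VField E K} {p : K} (h : SmoothAt X p) (hXY : Y =ᶠ[𝓝 p] X) :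
    SmoothAt Y p := by
  refine ContMDiffAt.congr_of_eventuallyEq h ?_
  filter_upwards [hXY] with q hq
  rw [hq]

theorem SmoothAt.mvfderiv_apply {f : K → ℝ} {X : VField E K} {p : K}
    (hf : ContMDiffAt 𝓘(ℝ, E) 𝓘(ℝ, ℝ) ∞ f p) (hX : SmoothAt X p) :
    ContMDiffAt 𝓘(ℝ, E) 𝓘(ℝ, ℝ) ∞ (fun q => mvfderiv 𝓘(ℝ, E) f q (X q)) p := by
  have h1 := hf.mfderiv_const (m := ∞) (by simp)
  have h2 : ContMDiffAt 𝓘(ℝ, E) 𝓘(ℝ, ℝ).tangent ∞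
      (fun q => (⟨f q, mfderiv 𝓘(ℝ, E) 𝓘(ℝ, ℝ) f q (X q)⟩ : TangentBundle 𝓘(ℝ, ℝ) ℝ)) p :=
    ContMDiffAt.clm_apply_of_inCoordinates h1 hX hf
  exact (contMDiff_snd_tangentBundle_modelSpace ℝ 𝓘(ℝ, ℝ)).contMDiffAt.comp p h2

theorem smoothAt_extend {p : K} (v : TangentSpace 𝓘(ℝ, E) p) :
    SmoothAt (FiberBundle.extend E v) p :=
  FiberBundle.contMDiffAt_extend 𝓘(ℝ, E) E v

theorem SmoothAt.add {X Y : VField E K} {p : K} (hX : SmoothAt X p) (hY : SmoothAt Y p) :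
    SmoothAt (X + Y) p := ContMDiffAt.add_section hX hY

theorem SmoothAt.smul {f : K → ℝ} {X : VField E K} {p : K}
    (hf : ContMDiffAt 𝓘(ℝ, E) 𝓘(ℝ, ℝ) ∞ f p) (hX : SmoothAt X p) :
    SmoothAt (f • X) p := ContMDiffAt.smul_section hf hX

theorem SmoothAt.sum {ι : Type*} (s : Finset ι) {X : ι → VField E K} {p : K}
    (hX : ∀ i ∈ s, SmoothAt (X i) p) : SmoothAt (fun q => ∑ i ∈ s, X i q) p :=
  ContMDiffAt.sum_section hX

theorem SmoothAt.mlieBracket [FiniteDimensional ℝ E] {X Y : VField E K} {p : K}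
    (hX : SmoothAt X p) (hY : SmoothAt Y p) :
    SmoothAt (mlieBracket 𝓘(ℝ, E) X Y) p :=
  haveI := FiniteDimensional.complete ℝ E
  haveI : IsManifold 𝓘(ℝ, E) (minSmoothness ℝ 2) K := by
    rw [minSmoothness_of_isRCLikeNormedField]
    infer_instance
  haveI : IsManifold 𝓘(ℝ, E) (∞ + 1) K := by simpa using ‹IsManifold 𝓘(ℝ, E) ∞ K›
  ContMDiffAt.mlieBracket_vectorField (n := ⊤) (m := ⊤) hX hY (by simp)

omit [IsManifold 𝓘(ℝ, E) ∞ K] in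
theorem contMDiffAt_det {ι : Type*} [Fintype ι] [DecidableEq ι] {M : K → Matrix ι ι ℝ} {p : K}
    (hM : ∀ i j, ContMDiffAt 𝓘(ℝ, E) 𝓘(ℝ, ℝ) ∞ (fun q => M q i j) p) :
    ContMDiffAt 𝓘(ℝ, E) 𝓘(ℝ, ℝ) ∞ (fun q => (M q).det) p := by
  simp only [Matrix.det_apply']
  refine ContMDiffAt.sum fun σ _ => contMDiffAt_const.mul (ContMDiffAt.prod fun i _ => hM _ _)

variable [RiemannianBundle (fun p : K => TangentSpace 𝓘(ℝ, E) p)]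
    [IsContMDiffRiemannianBundle 𝓘(ℝ, E) ∞ E (fun p : K => TangentSpace 𝓘(ℝ, E) p)]

theorem SmoothAt.inner {X Y : VField E K} {p : K} (hX : SmoothAt X p) (hY : SmoothAt Y p) :
    ContMDiffAt 𝓘(ℝ, E) 𝓘(ℝ, ℝ) ∞ (fun q => ⟪X q, Y q⟫) p :=
  ContMDiffAt.inner_bundle (E := fun p : K => TangentSpace 𝓘(ℝ, E) p) hX hY

theorem DiffAt.inner {X Y : VField E K} {p : K} (hX : DiffAt X p) (hY : DiffAt Y p) :
    MDifferentiableAt 𝓘(ℝ, E) 𝓘(ℝ, ℝ) (fun q => ⟪X q, Y q⟫) p :=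
  MDifferentiableAt.inner_bundle (E := fun p : K => TangentSpace 𝓘(ℝ, E) p) hX hY

/-- A field with values in the span of smooth fields that are independent at `p` is smooth at `p`
if its inner products with these fields are. -/
theorem smoothAt_of_inner {ι : Type*} [Fintype ι] {s : ι → VField E K} {p : K}
    (hs : ∀ i, SmoothAt (s i) p) (hli : LinearIndependent ℝ fun i => s i p) {W : VField E K}
    (hW : ∀ᶠ q in 𝓝 p, W q ∈ Submodule.span ℝ (Set.range fun i => s i q))
    (hin : ∀ i, ContMDiffAt 𝓘(ℝ, E) 𝓘(ℝ, ℝ) ∞ (fun q => ⟪s i q, W q⟫) p) :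
    SmoothAt W p := by
  classical
  let G : K → Matrix ι ι ℝ := fun q => Matrix.gram ℝ fun i => s i q
  have hG : ∀ i j, ContMDiffAt 𝓘(ℝ, E) 𝓘(ℝ, ℝ) ∞ (fun q => G q i j) p := fun i j =>
    (hs i).inner (hs j)
  have hdet : ContMDiffAt 𝓘(ℝ, E) 𝓘(ℝ, ℝ) ∞ (fun q => (G q).det) p := contMDiffAt_det hG
  have h0 : (G p).det ≠ 0 := Matrix.det_gram_ne_zero_iff_linearIndependent.2 hli
  -- Cramer's rule for the Gram system: these are the coefficients of `W` in terms of the `s i`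
  -- wherever the Gram determinant is nonzero, hence near `p`, and they are smooth at `p` because
  -- determinants are polynomial.
  let c : ι → K → ℝ := fun i q =>
    ((G q).updateCol i fun j => ⟪s j q, W q⟫).det * ((G q).det)⁻¹
  have hc : ∀ i, ContMDiffAt 𝓘(ℝ, E) 𝓘(ℝ, ℝ) ∞ (c i) p := by
    intro i
    refine (contMDiffAt_det fun j k => ?_).mul (hdet.inv₀ h0)
    by_cases hk : k = i
    · subst hk; simpa using hin j
    · simpa [Matrix.updateCol_ne hk] using hG j k
  have hsum : SmoothAt (fun q => ∑ i, (c i • s i : VField E K) q) p :=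
    SmoothAt.sum _ fun i _ => SmoothAt.smul (hc i) (hs i)
  refine hsum.congr ?_
  filter_upwards [hW, hdet.continuousAt.eventually_ne h0] with q hq hq0
  obtain ⟨a, ha⟩ := (Submodule.mem_span_range_iff_exists_fun ℝ).1 hq
  have hb : (fun j => ⟪s j q, W q⟫) = (G q).mulVec a := by
    ext j
    simp [← ha, inner_sum, inner_smul_right, Matrix.mulVec, dotProduct, G, mul_comm]
  rw [← ha]
  refine Finset.sum_congr rfl fun i _ => ?_
  have : c i q = a i := by
    have h1 : ((G q).updateCol i fun j => ⟪s j q, W q⟫).det = (G q).det * a i := by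
      rw [hb, ← Matrix.cramer_apply, Matrix.cramer_eq_adjugate_mulVec, Matrix.mulVec_mulVec,
        Matrix.adjugate_mul]
      simp [Matrix.smul_mulVec]
    simp only [c, h1]
    field_simp
  rw [← this]
  rfl

end

/-! ### The Koszul expression and its tensoriality -/

section

variable {E : Type*} [NormedAddCommGroup E] [NormedSpace ℝ E]
  {K : Type*} [TopologicalSpace K] [ChartedSpace E K] [IsManifold 𝓘(ℝ, E) ∞ K]
  [RiemannianBundle (fun p : K => TangentSpace 𝓘(ℝ, E) p)]
  [IsContMDiffRiemannianBundle 𝓘(ℝ, E) ∞ E (fun p : K => TangentSpace 𝓘(ℝ, E) p)]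

omit [IsManifold 𝓘(ℝ, E) ∞ K]
  [IsContMDiffRiemannianBundle 𝓘(ℝ, E) ∞ E (fun p : K => TangentSpace 𝓘(ℝ, E) p)] in
theorem derivInner_eq (X Y Z : VField E K) (p : K) :
    derivInner X Y Z p = mvfderiv 𝓘(ℝ, E) (fun q : K => ⟪Y q, Z q⟫) p (X p) := rfl

omit [IsManifold 𝓘(ℝ, E) ∞ K]
  [IsContMDiffRiemannianBundle 𝓘(ℝ, E) ∞ E (fun p : K => TangentSpace 𝓘(ℝ, E) p)] in
theorem derivInner_comm (X Y Z : VField E K) (p : K) :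
    derivInner X Y Z p = derivInner X Z Y p := by
  simp only [derivInner_eq, real_inner_comm]

omit [IsManifold 𝓘(ℝ, E) ∞ K]
  [IsContMDiffRiemannianBundle 𝓘(ℝ, E) ∞ E (fun p : K => TangentSpace 𝓘(ℝ, E) p)] in
theorem derivInner_add_left (X X' Y Z : VField E K) (p : K) :
    derivInner (X + X') Y Z p = derivInner X Y Z p + derivInner X' Y Z p :=
  map_add (mvfderiv 𝓘(ℝ, E) (fun q : K => ⟪Y q, Z q⟫) p) (X p) (X' p)

omit [IsManifold 𝓘(ℝ, E) ∞ K]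
  [IsContMDiffRiemannianBundle 𝓘(ℝ, E) ∞ E (fun p : K => TangentSpace 𝓘(ℝ, E) p)] in
theorem derivInner_smul_left (f : K → ℝ) (X Y Z : VField E K) (p : K) :
    derivInner (f • X) Y Z p = f p * derivInner X Y Z p :=
  map_smul (mvfderiv 𝓘(ℝ, E) (fun q : K => ⟪Y q, Z q⟫) p) (f p) (X p)

theorem derivInner_add_right (X : VField E K) {Y Z Z' : VField E K} {p : K} (hY : DiffAt Y p)
    (hZ : DiffAt Z p) (hZ' : DiffAt Z' p) :
    derivInner X Y (Z + Z') p = derivInner X Y Z p + derivInner X Y Z' p := by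
  have h : (fun q : K => ⟪Y q, (Z + Z') q⟫) = (fun q => ⟪Y q, Z q⟫) + fun q => ⟪Y q, Z' q⟫ := by
    ext q; exact inner_add_right _ _ _
  rw [derivInner_eq, h, mvfderiv_add (hY.inner hZ) (hY.inner hZ')]
  rfl

theorem derivInner_smul_right (X : VField E K) {Y Z : VField E K} {p : K} {f : K → ℝ}
    (hf : MDifferentiableAt 𝓘(ℝ, E) 𝓘(ℝ, ℝ) f p) (hY : DiffAt Y p) (hZ : DiffAt Z p) :
    derivInner X Y (f • Z) p =
      f p * derivInner X Y Z p + mvfderiv 𝓘(ℝ, E) f p (X p) * ⟪Y p, Z p⟫ := by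
  have h : (fun q : K => ⟪Y q, (f • Z) q⟫) = f * (fun q => ⟪Y q, Z q⟫) := by
    ext q; exact inner_smul_right _ _ _
  rw [derivInner_eq, h, mvfderiv_mul hf (hY.inner hZ)]
  simp [derivInner_eq, mul_comm]

theorem derivInner_add_middle (X : VField E K) {Y Z Z' : VField E K} {p : K} (hY : DiffAt Y p)
    (hZ : DiffAt Z p) (hZ' : DiffAt Z' p) :
    derivInner X (Z + Z') Y p = derivInner X Z Y p + derivInner X Z' Y p := by
  rw [derivInner_comm, derivInner_add_right X hY hZ hZ', derivInner_comm X Y, derivInner_comm X Y]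

theorem derivInner_smul_middle (X : VField E K) {Y Z : VField E K} {p : K} {f : K → ℝ}
    (hf : MDifferentiableAt 𝓘(ℝ, E) 𝓘(ℝ, ℝ) f p) (hY : DiffAt Y p) (hZ : DiffAt Z p) :
    derivInner X (f • Z) Y p =
      f p * derivInner X Z Y p + mvfderiv 𝓘(ℝ, E) f p (X p) * ⟪Z p, Y p⟫ := by
  rw [derivInner_comm, derivInner_smul_right X hf hY hZ, derivInner_comm X Y, real_inner_comm]

section Bracket

variable [FiniteDimensional ℝ E]

omit [RiemannianBundle (fun p : K => TangentSpace 𝓘(ℝ, E) p)]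
  [IsContMDiffRiemannianBundle 𝓘(ℝ, E) ∞ E (fun p : K => TangentSpace 𝓘(ℝ, E) p)] in
theorem mlieBracket_smul_right_apply (X : VField E K) {Y : VField E K} {p : K} {f : K → ℝ}
    (hf : MDifferentiableAt 𝓘(ℝ, E) 𝓘(ℝ, ℝ) f p) (hY : DiffAt Y p) :
    mlieBracket 𝓘(ℝ, E) X (f • Y) p =
      mvfderiv 𝓘(ℝ, E) f p (X p) • Y p + f p • mlieBracket 𝓘(ℝ, E) X Y p :=
  haveI := FiniteDimensional.complete ℝ E
  haveI : IsManifold 𝓘(ℝ, E) 1 K := .of_le (n := ∞) (by simp)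
  mlieBracket_smul_right hf hY

omit [RiemannianBundle (fun p : K => TangentSpace 𝓘(ℝ, E) p)]
  [IsContMDiffRiemannianBundle 𝓘(ℝ, E) ∞ E (fun p : K => TangentSpace 𝓘(ℝ, E) p)] in
theorem mlieBracket_smul_left_apply (X : VField E K) {Y : VField E K} {p : K} {f : K → ℝ}
    (hf : MDifferentiableAt 𝓘(ℝ, E) 𝓘(ℝ, ℝ) f p) (hY : DiffAt Y p) :
    mlieBracket 𝓘(ℝ, E) (f • Y) X p =
      (-mvfderiv 𝓘(ℝ, E) f p (X p)) • Y p + f p • mlieBracket 𝓘(ℝ, E) Y X p :=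
  haveI := FiniteDimensional.complete ℝ E
  mlieBracket_smul_left hf hY

omit [RiemannianBundle (fun p : K => TangentSpace 𝓘(ℝ, E) p)]
  [IsContMDiffRiemannianBundle 𝓘(ℝ, E) ∞ E (fun p : K => TangentSpace 𝓘(ℝ, E) p)] in
theorem mlieBracket_add_right_apply (X : VField E K) {Y Z : VField E K} {p : K}
    (hY : DiffAt Y p) (hZ : DiffAt Z p) :
    mlieBracket 𝓘(ℝ, E) X (Y + Z) p =
      mlieBracket 𝓘(ℝ, E) X Y p + mlieBracket 𝓘(ℝ, E) X Z p :=
  haveI := FiniteDimensional.complete ℝ E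
  mlieBracket_add_right hY hZ

omit [RiemannianBundle (fun p : K => TangentSpace 𝓘(ℝ, E) p)]
  [IsContMDiffRiemannianBundle 𝓘(ℝ, E) ∞ E (fun p : K => TangentSpace 𝓘(ℝ, E) p)] in
theorem mlieBracket_add_left_apply (X : VField E K) {Y Z : VField E K} {p : K}
    (hY : DiffAt Y p) (hZ : DiffAt Z p) :
    mlieBracket 𝓘(ℝ, E) (Y + Z) X p =
      mlieBracket 𝓘(ℝ, E) Y X p + mlieBracket 𝓘(ℝ, E) Z X p :=
  haveI := FiniteDimensional.complete ℝ E
  mlieBracket_add_left hY hZ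

/-- The Leibniz terms of the derivatives of inner products cancel those of the brackets. Hence the
value depends only on `Z p`, and the choice of local extensions in `leviCivita` does not matter. -/
theorem tensorialAt_koszul_right {X Y : VField E K} {p : K} (hX : DiffAt X p) (hY : DiffAt Y p) :
    TensorialAt 𝓘(ℝ, E) E (fun Z : VField E K => koszul X Y Z p) p where
  smul {f Z} hf hZ := by
    have e1 := derivInner_smul_right X hf hY hZ
    have e2 := derivInner_smul_middle Y hf hX hZ
    have e3 := derivInner_smul_left f Z X Y p
    have e4 := mlieBracket_smul_right_apply X hf hZ
    have e5 := mlieBracket_smul_right_apply Y hf hZ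
    have e6 : ⟪mlieBracket 𝓘(ℝ, E) X Y p, (f • Z) p⟫ = f p * ⟪mlieBracket 𝓘(ℝ, E) X Y p, Z p⟫ :=
      inner_smul_right _ _ _
    simp only [koszul, e1, e2, e3, e4, e5, e6, inner_add_left, real_inner_smul_left, smul_eq_mul]
    rw [real_inner_comm (Z p) (Y p)]
    ring
  add {Z Z'} hZ hZ' := by
    have e1 := derivInner_add_right X hY hZ hZ'
    have e2 := derivInner_add_middle Y hX hZ hZ'
    have e3 := derivInner_add_left Z Z' X Y p
    have e4 := mlieBracket_add_right_apply X hZ hZ'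
    have e5 := mlieBracket_add_right_apply Y hZ hZ'
    have e6 : ⟪mlieBracket 𝓘(ℝ, E) X Y p, (Z + Z') p⟫ =
      ⟪mlieBracket 𝓘(ℝ, E) X Y p, Z p⟫ + ⟪mlieBracket 𝓘(ℝ, E) X Y p, Z' p⟫ :=
      inner_add_right _ _ _
    simp only [koszul, e1, e2, e3, e4, e5, e6, inner_add_left]
    ring

theorem tensorialAt_koszul_left {Y Z : VField E K} {p : K} (hY : DiffAt Y p) (hZ : DiffAt Z p) :
    TensorialAt 𝓘(ℝ, E) E (fun X : VField E K => koszul X Y Z p) p where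
  smul {f X} hf hX := by
    have e1 := derivInner_smul_left f X Y Z p
    have e2 := derivInner_smul_right Y hf hZ hX
    have e3 := derivInner_smul_middle Z hf hY hX
    have e4 := mlieBracket_smul_left_apply Y hf hX
    have e5 := mlieBracket_smul_left_apply Z hf hX
    have e6 : ⟪mlieBracket 𝓘(ℝ, E) Y Z p, (f • X) p⟫ = f p * ⟪mlieBracket 𝓘(ℝ, E) Y Z p, X p⟫ :=
      inner_smul_right _ _ _
    simp only [koszul, e1, e2, e3, e4, e5, e6, inner_add_left, real_inner_smul_left, smul_eq_mul]
    rw [real_inner_comm (Z p) (X p)]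
    ring
  add {X X'} hX hX' := by
    have e1 := derivInner_add_left X X' Y Z p
    have e2 := derivInner_add_right Y hZ hX hX'
    have e3 := derivInner_add_middle Z hY hX hX'
    have e4 := mlieBracket_add_left_apply Y hX hX'
    have e5 := mlieBracket_add_left_apply Z hX hX'
    have e6 : ⟪mlieBracket 𝓘(ℝ, E) Y Z p, (X + X') p⟫ =
      ⟪mlieBracket 𝓘(ℝ, E) Y Z p, X p⟫ + ⟪mlieBracket 𝓘(ℝ, E) Y Z p, X' p⟫ :=
      inner_add_right _ _ _
    simp only [koszul, e1, e2, e3, e4, e5, e6, inner_add_left]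
    ring

/-- The defining property of the Levi-Civita connection. -/
theorem inner_leviCivita {X Y Z : VField E K} {p : K} (hX : DiffAt X p) (hY : DiffAt Y p)
    (hZ : DiffAt Z p) : ⟪leviCivita X Y p, Z p⟫ = koszul X Y Z p := by
  let b := stdOrthonormalBasis ℝ (TangentSpace 𝓘(ℝ, E) p)
  have ht := tensorialAt_koszul_right hX hY
  let ℓ := TensorialAt.mkHom (fun Z : VField E K => koszul X Y Z p) p ht
  have h : ℓ (Z p) = koszul X Y Z p := ht.mkHom_apply hZ
  have h1 : ℓ (Z p) = ∑ i, ⟪b i, Z p⟫ * ℓ (b i) := by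
    conv_lhs => rw [← b.sum_repr' (Z p)]
    rw [map_sum]
    exact Finset.sum_congr rfl fun i _ => map_smul ℓ _ _
  rw [← h, h1, leviCivita, sum_inner]
  refine Finset.sum_congr rfl fun i _ => ?_
  rw [real_inner_smul_left, mul_comm]
  rfl

end Bracket

end

/-! ### Brackets as derivations and the Levi-Civita connection -/

section

variable {E : Type*} [NormedAddCommGroup E] [NormedSpace ℝ E]
  {K : Type*} [TopologicalSpace K] [ChartedSpace E K] [IsManifold 𝓘(ℝ, E) ∞ K]

theorem IsSmooth.add {X Y : VField E K} (hX : IsSmooth X) (hY : IsSmooth Y) : IsSmooth (X + Y) :=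
  fun p => SmoothAt.add (hX p) (hY p)

omit [IsManifold 𝓘(ℝ, E) ∞ K] in
theorem mvfderiv_congr {f g : K → ℝ} {p : K} (h : f =ᶠ[𝓝 p] g) :
    mvfderiv 𝓘(ℝ, E) f p = mvfderiv 𝓘(ℝ, E) g p := by
  ext v
  exact congrArg (fun L : E →L[ℝ] ℝ => L v) h.mfderiv_eq

variable [FiniteDimensional ℝ E]

theorem IsSmooth.mlieBracket {X Y : VField E K} (hX : IsSmooth X) (hY : IsSmooth Y) :
    IsSmooth (mlieBracket 𝓘(ℝ, E) X Y) :=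
  fun p => SmoothAt.mlieBracket (hX p) (hY p)

theorem jacobi_mlieBracket {X Y Z : VField E K} {p : K} (hX : SmoothAt X p) (hY : SmoothAt Y p)
    (hZ : SmoothAt Z p) :
    mlieBracket 𝓘(ℝ, E) X (mlieBracket 𝓘(ℝ, E) Y Z) p =
      mlieBracket 𝓘(ℝ, E) (mlieBracket 𝓘(ℝ, E) X Y) Z p
        + mlieBracket 𝓘(ℝ, E) Y (mlieBracket 𝓘(ℝ, E) X Z) p := by
  have := FiniteDimensional.complete ℝ E
  have : IsManifold 𝓘(ℝ, E) (minSmoothness ℝ 3) K := by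
    rw [minSmoothness_of_isRCLikeNormedField]
    exact .of_le (n := ∞) (WithTop.coe_le_coe.2 le_top : ((3 : ℕ∞) : WithTop ℕ∞) ≤ ∞)
  have h2 : minSmoothness ℝ 2 ≤ ∞ := by
    rw [minSmoothness_of_isRCLikeNormedField]
    exact (WithTop.coe_le_coe.2 le_top : ((2 : ℕ∞) : WithTop ℕ∞) ≤ ∞)
  exact leibniz_identity_mlieBracket_apply (ContMDiffAt.of_le hX h2) (ContMDiffAt.of_le hY h2)
    (ContMDiffAt.of_le hZ h2)

/-- The bracket of vector fields acts on functions as the commutator of the derivations. -/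
theorem mvfderiv_mlieBracket {X Y : VField E K} {p : K} {f : K → ℝ} (hX : IsSmooth X)
    (hY : IsSmooth Y) (hf : ∀ᶠ q in 𝓝 p, ContMDiffAt 𝓘(ℝ, E) 𝓘(ℝ, ℝ) ∞ f q) :
    mvfderiv 𝓘(ℝ, E) f p (mlieBracket 𝓘(ℝ, E) X Y p) =
      mvfderiv 𝓘(ℝ, E) (fun q => mvfderiv 𝓘(ℝ, E) f q (Y q)) p (X p)
        - mvfderiv 𝓘(ℝ, E) (fun q => mvfderiv 𝓘(ℝ, E) f q (X q)) p (Y p) := by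
  -- If the tangent space is zero, both sides vanish. Otherwise a nonzero `w` is extended to a local
  -- field `W`, and the Jacobi identity for `X`, `Y`, `f • W` is compared with `f` times the one for
  -- `X`, `Y`, `W`. The difference is the claimed identity multiplied by `W p`.
  by_cases hE : ∃ w : TangentSpace 𝓘(ℝ, E) p, w ≠ 0
  swap
  · push Not at hE
    rw [hE (mlieBracket 𝓘(ℝ, E) X Y p), hE (X p), hE (Y p)]
    simp
  obtain ⟨w, hw⟩ := hE
  obtain ⟨s, hs, hW⟩ := FiberBundle.exists_contMDiffOn_extend (k := ∞) 𝓘(ℝ, E) E w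
  set W : VField E K := FiberBundle.extend E w with hWdef
  have hWs : ∀ᶠ q in 𝓝 p, SmoothAt W q := by
    filter_upwards [eventually_mem_nhds_iff.2 hs] with q hq
    exact (hW q (mem_of_mem_nhds hq)).contMDiffAt hq
  have hfp := hf.self_of_nhds
  have hWp := hWs.self_of_nhds
  have key : ∀ Z : VField E K, IsSmooth Z → mlieBracket 𝓘(ℝ, E) Z (f • W) =ᶠ[𝓝 p]
      (fun q => mvfderiv 𝓘(ℝ, E) f q (Z q)) • W + f • mlieBracket 𝓘(ℝ, E) Z W := by
    intro Z _
    filter_upwards [hf, hWs] with q hfq hWq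
    exact mlieBracket_smul_right_apply Z (hfq.mdifferentiableAt (by simp)) hWq.diffAt
  have second : ∀ A B : VField E K, IsSmooth A → IsSmooth B →
      mlieBracket 𝓘(ℝ, E) A (mlieBracket 𝓘(ℝ, E) B (f • W)) p =
        mvfderiv 𝓘(ℝ, E) (fun q => mvfderiv 𝓘(ℝ, E) f q (B q)) p (A p) • W p
        + mvfderiv 𝓘(ℝ, E) f p (B p) • mlieBracket 𝓘(ℝ, E) A W p
        + (mvfderiv 𝓘(ℝ, E) f p (A p) • mlieBracket 𝓘(ℝ, E) B W p
        + f p • mlieBracket 𝓘(ℝ, E) A (mlieBracket 𝓘(ℝ, E) B W) p) := by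
    intro A B hA hB
    have hBf := SmoothAt.mvfderiv_apply hfp (hB p)
    have hBW := SmoothAt.mlieBracket (hB p) hWp
    rw [Filter.EventuallyEq.mlieBracket_vectorField_eq (Filter.EventuallyEq.refl _ A) (key B hB),
      mlieBracket_add_right_apply A (SmoothAt.smul hBf hWp).diffAt (SmoothAt.smul hfp hBW).diffAt,
      mlieBracket_smul_right_apply A (hBf.mdifferentiableAt (by simp)) hWp.diffAt,
      mlieBracket_smul_right_apply A (hfp.mdifferentiableAt (by simp)) hBW.diffAt]
  have j1 := jacobi_mlieBracket (hX p) (hY p) (SmoothAt.smul hfp hWp)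
  have j2 := jacobi_mlieBracket (hX p) (hY p) hWp
  rw [second X Y hX hY, second Y X hY hX,
    mlieBracket_smul_right_apply _ (hfp.mdifferentiableAt (by simp)) hWp.diffAt, j2] at j1
  have h0 : (mvfderiv 𝓘(ℝ, E) f p (mlieBracket 𝓘(ℝ, E) X Y p) -
      (mvfderiv 𝓘(ℝ, E) (fun q => mvfderiv 𝓘(ℝ, E) f q (Y q)) p (X p)
        - mvfderiv 𝓘(ℝ, E) (fun q => mvfderiv 𝓘(ℝ, E) f q (X q)) p (Y p))) • W p = 0 := by
    rw [sub_smul, sub_smul]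
    rw [smul_add] at j1
    linear_combination (norm := module) -j1
  have hWw : W p = w := FiberBundle.extend_apply_self E w
  rw [hWw] at h0
  exact sub_eq_zero.1 ((smul_eq_zero.1 h0).resolve_right hw)

variable [RiemannianBundle (fun p : K => TangentSpace 𝓘(ℝ, E) p)]
  [IsContMDiffRiemannianBundle 𝓘(ℝ, E) ∞ E (fun p : K => TangentSpace 𝓘(ℝ, E) p)]

theorem SmoothAt.koszul {X Y Z : VField E K} {p : K} (hX : SmoothAt X p) (hY : SmoothAt Y p)
    (hZ : SmoothAt Z p) : ContMDiffAt 𝓘(ℝ, E) 𝓘(ℝ, ℝ) ∞ (koszul X Y Z) p := by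
  have h : ∀ {A B C : VField E K}, SmoothAt A p → SmoothAt B p → SmoothAt C p →
      ContMDiffAt 𝓘(ℝ, E) 𝓘(ℝ, ℝ) ∞ (derivInner A B C) p := fun hA hB hC =>
    SmoothAt.mvfderiv_apply (SmoothAt.inner hB hC) hA
  exact contMDiffAt_const.mul ((((((h hX hY hZ).add (h hY hZ hX)).sub (h hZ hX hY)).add
    (SmoothAt.inner (SmoothAt.mlieBracket hX hY) hZ)).sub
    (SmoothAt.inner (SmoothAt.mlieBracket hX hZ) hY)).sub
    (SmoothAt.inner (SmoothAt.mlieBracket hY hZ) hX))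

/-- A vector field is smooth at `p` if its inner products with the fields that are smooth near `p`
are smooth at `p`. -/
theorem smoothAt_of_forall_inner {W : VField E K} {p : K}
    (h : ∀ Z : VField E K, (∀ᶠ q in 𝓝 p, SmoothAt Z q) →
      ContMDiffAt 𝓘(ℝ, E) 𝓘(ℝ, ℝ) ∞ (fun q => ⟪Z q, W q⟫) p) : SmoothAt W p := by
  let t := trivializationAt E (TangentSpace 𝓘(ℝ, E) (M := K)) p
  let b := Module.finBasis ℝ E
  have hp : p ∈ t.baseSet := FiberBundle.mem_baseSet_trivializationAt E _ p
  have hfr := t.isLocalFrameOn_localFrame_baseSet 𝓘(ℝ, E) ∞ b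
  have hsm : ∀ i, ∀ q ∈ t.baseSet, SmoothAt (t.localFrame b i) q := fun i q hq =>
    hfr.contMDiffAt t.open_baseSet hq i
  -- The test fields are a local frame; its members are smooth on the whole base set, so the
  -- hypothesis applies to them.
  refine smoothAt_of_inner (fun i => hsm i p hp) (hfr.linearIndependent hp) ?_ fun i => h _ ?_
  · filter_upwards [t.open_baseSet.mem_nhds hp] with q hq
    exact hfr.generating hq trivial
  · filter_upwards [t.open_baseSet.mem_nhds hp] with q hq
    exact hsm i q hq

/-- The pairing of `leviCivita X Y` with a test field is a Koszul expression at every point where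
the test field is smooth, so test fields smooth in a neighbourhood are needed. -/
theorem IsSmooth.leviCivita {X Y : VField E K} (hX : IsSmooth X) (hY : IsSmooth Y) :
    IsSmooth (leviCivita X Y) := by
  refine fun p => smoothAt_of_forall_inner fun Z hZ => ?_
  refine (SmoothAt.koszul (hX p) (hY p) hZ.self_of_nhds).congr_of_eventuallyEq ?_
  filter_upwards [hZ] with q hq
  rw [real_inner_comm, inner_leviCivita (hX.diffAt q) (hY.diffAt q) hq.diffAt]

omit [FiniteDimensional ℝ E]
  [IsContMDiffRiemannianBundle 𝓘(ℝ, E) ∞ E (fun p : K => TangentSpace 𝓘(ℝ, E) p)] in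
theorem eq_of_forall_inner {p : K} {x y : TangentSpace 𝓘(ℝ, E) p}
    (h : ∀ Z : VField E K, DiffAt Z p → ⟪x, Z p⟫ = ⟪y, Z p⟫) : x = y := by
  refine ext_inner_right ℝ fun z => ?_
  have := h _ (smoothAt_extend z).diffAt
  rwa [FiberBundle.extend_apply_self] at this

theorem leviCivita_add_right {X Y Z : VField E K} {p : K} (hX : DiffAt X p) (hY : DiffAt Y p)
    (hZ : DiffAt Z p) : leviCivita X (Y + Z) p = leviCivita X Y p + leviCivita X Z p := by
  refine eq_of_forall_inner fun W hW => ?_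
  have hYZ : DiffAt (Y + Z) p := mdifferentiableAt_add_section hY hZ
  rw [inner_add_left, inner_leviCivita hX hYZ hW, inner_leviCivita hX hY hW,
    inner_leviCivita hX hZ hW]
  have e1 := derivInner_add_middle X hW hY hZ
  have e2 := derivInner_add_left Y Z W X p
  have e3 := derivInner_add_right W hX hY hZ
  have e4 := mlieBracket_add_right_apply X hY hZ
  have e5 := mlieBracket_add_left_apply W hY hZ
  have e6 : ⟪mlieBracket 𝓘(ℝ, E) X W p, (Y + Z) p⟫ =
    ⟪mlieBracket 𝓘(ℝ, E) X W p, Y p⟫ + ⟪mlieBracket 𝓘(ℝ, E) X W p, Z p⟫ := inner_add_right _ _ _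
  simp only [CPSRM.koszul, e1, e2, e3, e4, e5, e6, inner_add_left]
  ring

theorem leviCivita_add_left {X Y Z : VField E K} {p : K} (hX : DiffAt X p) (hY : DiffAt Y p)
    (hZ : DiffAt Z p) : leviCivita (X + Y) Z p = leviCivita X Z p + leviCivita Y Z p := by
  refine eq_of_forall_inner fun W hW => ?_
  rw [inner_add_left, inner_leviCivita (mdifferentiableAt_add_section hX hY) hZ hW,
    inner_leviCivita hX hZ hW, inner_leviCivita hY hZ hW]
  exact (tensorialAt_koszul_left hZ hW).add hX hY

theorem leviCivita_smul_left {X Y : VField E K} {p : K} {f : K → ℝ}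
    (hf : MDifferentiableAt 𝓘(ℝ, E) 𝓘(ℝ, ℝ) f p) (hX : DiffAt X p) (hY : DiffAt Y p) :
    leviCivita (f • X) Y p = f p • leviCivita X Y p := by
  refine eq_of_forall_inner fun W hW => ?_
  rw [real_inner_smul_left, inner_leviCivita (hf.smul_section hX) hY hW, inner_leviCivita hX hY hW]
  exact (tensorialAt_koszul_left hY hW).smul hf hX

/-- The Levi-Civita connection is torsion-free. -/
theorem leviCivita_sub_leviCivita {X Y : VField E K} {p : K} (hX : DiffAt X p) (hY : DiffAt Y p) :
    leviCivita X Y p - leviCivita Y X p = mlieBracket 𝓘(ℝ, E) X Y p := by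
  refine eq_of_forall_inner fun W hW => ?_
  rw [inner_sub_left, inner_leviCivita hX hY hW, inner_leviCivita hY hX hW]
  have e1 : mlieBracket 𝓘(ℝ, E) Y X p = -mlieBracket 𝓘(ℝ, E) X Y p := mlieBracket_swap_apply
  simp only [CPSRM.koszul, e1, derivInner_comm X W Y, derivInner_comm Y W X,
    derivInner_comm W Y X, inner_neg_left]
  ring

/-- The Levi-Civita connection is metric. -/
theorem derivInner_eq_inner_leviCivita {X Y Z : VField E K} {p : K} (hX : DiffAt X p)
    (hY : DiffAt Y p) (hZ : DiffAt Z p) :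
    derivInner X Y Z p = ⟪leviCivita X Y p, Z p⟫ + ⟪Y p, leviCivita X Z p⟫ := by
  rw [real_inner_comm (leviCivita X Z p), inner_leviCivita hX hY hZ, inner_leviCivita hX hZ hY]
  have e1 : mlieBracket 𝓘(ℝ, E) Z Y p = -mlieBracket 𝓘(ℝ, E) Y Z p := mlieBracket_swap_apply
  simp only [CPSRM.koszul, e1, derivInner_comm X Z Y, derivInner_comm Z Y X,
    derivInner_comm Y Z X, inner_neg_left]
  ring

omit [IsContMDiffRiemannianBundle 𝓘(ℝ, E) ∞ E (fun p : K => TangentSpace 𝓘(ℝ, E) p)] in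
/-- The Levi-Civita connection is a local operator. -/
theorem leviCivita_congr {X X' Y Y' : VField E K} {p : K} (hX : X =ᶠ[𝓝 p] X')
    (hY : Y =ᶠ[𝓝 p] Y') : leviCivita X Y p = leviCivita X' Y' p := by
  have hd : ∀ A A' B B' C C' : VField E K, A =ᶠ[𝓝 p] A' → B =ᶠ[𝓝 p] B' → C =ᶠ[𝓝 p] C' →
      derivInner A B C p = derivInner A' B' C' p := by
    intro A A' B B' C C' hA hB hC
    have : (fun q : K => ⟪B q, C q⟫) =ᶠ[𝓝 p] fun q => ⟪B' q, C' q⟫ := by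
      filter_upwards [hB, hC] with q h1 h2
      rw [h1, h2]
    rw [derivInner_eq, derivInner_eq, mvfderiv_congr this, hA.self_of_nhds]
  refine Finset.sum_congr rfl fun i _ => ?_
  set Z : VField E K := FiberBundle.extend E (stdOrthonormalBasis ℝ (TangentSpace 𝓘(ℝ, E) p) i)
  have hZ : Z =ᶠ[𝓝 p] Z := .rfl
  have h : CPSRM.koszul X Y Z p = CPSRM.koszul X' Y' Z p := by
    rw [CPSRM.koszul, CPSRM.koszul, hd X X' Y Y' Z Z hX hY hZ, hd Y Y' Z Z X X' hY hZ hX, hd Z Z X X' Y Y' hZ hX hY,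
      hX.mlieBracket_vectorField_eq hY, hX.mlieBracket_vectorField_eq hZ,
      hY.mlieBracket_vectorField_eq hZ, hX.self_of_nhds, hY.self_of_nhds]
  rw [h]

end

/-! ### Algebraic Kähler curvature tensors -/

section

/-- An algebraic curvature tensor (additive in its arguments) on an abelian group with a compatible
complex structure. -/
structure IsKahlerCurvature {A : Type*} [AddCommGroup A] (J : A → A) (R : A → A → A → A → ℝ) :
    Prop where
  J_add : ∀ x y, J (x + y) = J x + J y
  J_sq : ∀ x, J (J x) = -x
  add : ∀ x x' y z w, R (x + x') y z w = R x y z w + R x' y z w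
  swap : ∀ x y z w, R x y z w = -R y x z w
  swap' : ∀ x y z w, R x y z w = -R x y w z
  bianchi : ∀ x y z w, R x y z w + R y z x w + R z x y w = 0
  kahler : ∀ x y z w, R x y (J z) (J w) = R x y z w

namespace IsKahlerCurvature

variable {A : Type*} [AddCommGroup A] {J : A → A} {R : A → A → A → A → ℝ}
  (h : IsKahlerCurvature J R)

include h

/-- The classical combination of four Bianchi identities, one for each cyclic shift of the
arguments, with the two skew symmetries. -/
theorem pair (x y z w : A) : R x y z w = R z w x y := by
  have b1 := h.bianchi x y z w
  have b2 := h.bianchi y z w x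
  have b3 := h.bianchi z w x y
  have b4 := h.bianchi w x y z
  have s1 := h.swap x y z w
  have s2 := h.swap' x y w z
  have s3 := h.swap' y z x w
  have s4 := h.swap' z x y w
  have s5 := h.swap' z w x y
  have s6 := h.swap' w y z x
  have s7 := h.swap' w x y z
  have s8 := h.swap' x z w y
  have s9 := h.swap x z y w
  have s10 := h.swap w y x z
  have s11 := h.swap y w x z
  have s12 := h.swap x z w y
  have s13 := h.swap z w y x
  have s14 := h.swap' y w z x
  have s15 := h.swap x y w z
  linarith

theorem add₂ (x y y' z w : A) : R x (y + y') z w = R x y z w + R x y' z w := by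
  rw [h.swap, h.add, h.swap y, h.swap y']; ring

theorem add₃ (x y z z' w : A) : R x y (z + z') w = R x y z w + R x y z' w := by
  rw [h.pair, h.add, h.pair z, h.pair z']

theorem add₄ (x y z w w' : A) : R x y z (w + w') = R x y z w + R x y z w' := by
  rw [h.swap', h.add₃, h.swap' x y w, h.swap' x y w']; ring

theorem neg₁ (x y z w : A) : R (-x) y z w = -R x y z w :=
  map_neg (AddMonoidHom.mk' (fun x => R x y z w) fun a b => h.add a b y z w) x

theorem neg₂ (x y z w : A) : R x (-y) z w = -R x y z w :=
  map_neg (AddMonoidHom.mk' (fun y => R x y z w) fun a b => h.add₂ x a b z w) y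

theorem neg₃ (x y z w : A) : R x y (-z) w = -R x y z w :=
  map_neg (AddMonoidHom.mk' (fun z => R x y z w) fun a b => h.add₃ x y a b w) z

theorem neg₄ (x y z w : A) : R x y z (-w) = -R x y z w :=
  map_neg (AddMonoidHom.mk' (fun w => R x y z w) fun a b => h.add₄ x y z a b) w

theorem J_neg (x : A) : J (-x) = -J x :=
  map_neg (AddMonoidHom.mk' J h.J_add) x

theorem kahler₁₂ (x y z w : A) : R (J x) (J y) z w = R x y z w := by
  rw [h.pair, h.kahler, h.pair]

theorem kahler₃ (x y z w : A) : R x y (J z) w = -R x y z (J w) := by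
  rw [← h.kahler x y z (J w), h.J_sq, h.neg₄, neg_neg]

theorem kahler₁ (x y z w : A) : R (J x) y z w = -R x (J y) z w := by
  rw [h.pair, h.kahler₃, h.pair]

/-- The quartic form `x ↦ R(x, Jx, Jx, x)` satisfies a deformed parallelogram identity. -/
theorem parallelogram (x y : A) :
    R (x + y) (J (x + y)) (J (x + y)) (x + y) + R (x + -y) (J (x + -y)) (J (x + -y)) (x + -y) =
      2 * R x (J x) (J x) x + 2 * R y (J y) (J y) y + 4 * R x y y x
        + 12 * R x (J y) (J y) x := by
  -- Of the terms with two `x` and two `y`, four equal R(x,Jy,Jy,x) and the other two equal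
  -- R(x,Jy,Jy,x) + R(x,y,y,x) by Bianchi. Terms of odd degree in `y` cancel between the two
  -- quartics and the others double, whence the coefficients 12 and 4.
  have c1 : R y (J x) (J y) x = R x (J y) (J y) x := by
    rw [h.swap, h.kahler₁, neg_neg]
  have c2 : R x (J y) (J x) y = R x (J y) (J y) x := by
    rw [h.kahler₃, h.swap', neg_neg]
  have c3 : R y (J x) (J x) y = R x (J y) (J y) x := by
    rw [h.swap, h.kahler₁, neg_neg, c2]
  have a1 : R y (J y) (J x) x = R x (J x) (J y) y := by
    rw [h.pair, h.swap, h.swap', neg_neg]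
  have a2 : R x (J x) (J y) y = R x (J y) (J y) x + R x y y x := by
    have b := h.bianchi x (J x) (J y) y
    have b1 : R (J x) (J y) x y = -R x y y x := by rw [h.kahler₁₂, h.swap']
    have b2 : R (J y) x (J x) y = -R x (J y) (J y) x := by rw [h.swap, c2]
    linarith
  simp only [h.J_add, h.J_neg, h.add, h.add₂, h.add₃, h.add₄, h.neg₁, h.neg₂, h.neg₃, h.neg₄]
  linarith

/-- A Kähler curvature tensor of constant holomorphic sectional curvature has the sectional
curvatures of a complex space form. -/
theorem apply_of_const_holSectional {g : A → A → ℝ} (v : ℝ)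
    (g_add : ∀ x x' y, g (x + x') y = g x y + g x' y) (g_comm : ∀ x y, g x y = g y x)
    (g_J : ∀ x y, g (J x) (J y) = g x y)
    (hol : ∀ x, R x (J x) (J x) x = v * g x x ^ 2) (x y : A) :
    R x y y x = v / 4 * (g x x * g y y - g x y ^ 2 + 3 * g x (J y) ^ 2) := by
  have g_add' : ∀ x y y', g x (y + y') = g x y + g x y' := fun x y y' => by
    rw [g_comm, g_add, g_comm y, g_comm y']
  have g_neg : ∀ x y, g (-x) y = -g x y := fun x y =>
    map_neg (AddMonoidHom.mk' (fun x => g x y) fun a b => g_add a b y) x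
  have g_neg' : ∀ x y, g x (-y) = -g x y := fun x y => by rw [g_comm, g_neg, g_comm]
  have p1 := h.parallelogram x y
  have p2 := h.parallelogram x (J y)
  have e : R x (J (J y)) (J (J y)) x = R x y y x := by
    rw [h.J_sq, h.neg₂, h.neg₃, neg_neg]
  rw [e] at p2
  simp only [hol, g_add, g_add', g_neg, g_neg', g_J, g_comm y x, g_comm (J y) x] at p1 p2
  -- Replacing `y` by `J y` interchanges the coefficients 4 and 12. Subtracting three times the
  -- second identity eliminates R(x,Jy,Jy,x) and leaves a multiple ±32 of R(x,y,y,x).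
  linear_combination (1 / 32) * (p1 - 3 * p2)

end IsKahlerCurvature

/-! ### Symmetries of the Riemannian curvature; complex space forms -/

variable {E : Type*} [NormedAddCommGroup E] [NormedSpace ℝ E]
  {K : Type*} [TopologicalSpace K] [ChartedSpace E K] [IsManifold 𝓘(ℝ, E) ∞ K]
  [FiniteDimensional ℝ E]
  [RiemannianBundle (fun p : K => TangentSpace 𝓘(ℝ, E) p)]
  [IsContMDiffRiemannianBundle 𝓘(ℝ, E) ∞ E (fun p : K => TangentSpace 𝓘(ℝ, E) p)]

theorem leviCivita_neg_left {X Y : VField E K} {p : K} (hX : DiffAt X p) (hY : DiffAt Y p) :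
    leviCivita (-X) Y p = -leviCivita X Y p := by
  have h := leviCivita_smul_left (f := fun _ => (-1 : ℝ)) mdifferentiableAt_const hX hY
  have e : (fun _ : K => (-1 : ℝ)) • X = -X := by
    ext q
    exact neg_one_smul ℝ (X q)
  rw [e, neg_one_smul] at h
  exact h

theorem leviCivita_eq_add {X Y : VField E K} (hX : IsSmooth X) (hY : IsSmooth Y) :
    leviCivita X Y = leviCivita Y X + mlieBracket 𝓘(ℝ, E) X Y := by
  ext q
  exact sub_eq_iff_eq_add'.1 (leviCivita_sub_leviCivita (hX.diffAt q) (hY.diffAt q))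

theorem curvature_swap {X Y Z : VField E K} (hX : IsSmooth X) (hY : IsSmooth Y) (hZ : IsSmooth Z)
    (p : K) : curvature X Y Z p = -curvature Y X Z p := by
  have h : mlieBracket 𝓘(ℝ, E) X Y = -mlieBracket 𝓘(ℝ, E) Y X := mlieBracket_swap
  rw [curvature, curvature, h, leviCivita_neg_left ((hY.mlieBracket hX).diffAt p) (hZ.diffAt p)]
  abel

theorem curvature_add_left {X X' Y Z : VField E K} (hX : IsSmooth X) (hX' : IsSmooth X')
    (hY : IsSmooth Y) (hZ : IsSmooth Z) (p : K) :
    curvature (X + X') Y Z p = curvature X Y Z p + curvature X' Y Z p := by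
  have h1 : leviCivita (X + X') Z = leviCivita X Z + leviCivita X' Z := by
    ext q
    exact leviCivita_add_left (hX.diffAt q) (hX'.diffAt q) (hZ.diffAt q)
  have h2 : mlieBracket 𝓘(ℝ, E) (X + X') Y =
      mlieBracket 𝓘(ℝ, E) X Y + mlieBracket 𝓘(ℝ, E) X' Y := by
    ext q
    exact mlieBracket_add_left_apply Y (hX.diffAt q) (hX'.diffAt q)
  rw [curvature, curvature, curvature, h1, h2,
    leviCivita_add_left (hX.diffAt p) (hX'.diffAt p) ((hY.leviCivita hZ).diffAt p),
    leviCivita_add_right (hY.diffAt p) ((hX.leviCivita hZ).diffAt p)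
      ((hX'.leviCivita hZ).diffAt p),
    leviCivita_add_left ((hX.mlieBracket hY).diffAt p) ((hX'.mlieBracket hY).diffAt p)
      (hZ.diffAt p)]
  abel

/-- The first Bianchi identity. -/
theorem curvature_bianchi {X Y Z : VField E K} (hX : IsSmooth X) (hY : IsSmooth Y)
    (hZ : IsSmooth Z) (p : K) :
    curvature X Y Z p + curvature Y Z X p + curvature Z X Y p = 0 := by
  -- Torsion-freeness used twice. In the cyclic sum the connection terms cancel, and the Jacobi
  -- identity disposes of the double brackets.
  have key : ∀ {A B C : VField E K}, IsSmooth A → IsSmooth B → IsSmooth C →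
      leviCivita A (leviCivita B C) p = leviCivita A (leviCivita C B) p
        + leviCivita (mlieBracket 𝓘(ℝ, E) B C) A p
        + mlieBracket 𝓘(ℝ, E) A (mlieBracket 𝓘(ℝ, E) B C) p := by
    intro A B C hA hB hC
    rw [leviCivita_eq_add hB hC, leviCivita_add_right (hA.diffAt p)
      ((hC.leviCivita hB).diffAt p) ((hB.mlieBracket hC).diffAt p),
      ← leviCivita_sub_leviCivita (hA.diffAt p) ((hB.mlieBracket hC).diffAt p)]
    abel
  have j := jacobi_mlieBracket (hX p) (hY p) (hZ p)
  have s1 : mlieBracket 𝓘(ℝ, E) (mlieBracket 𝓘(ℝ, E) X Y) Z p =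
      -mlieBracket 𝓘(ℝ, E) Z (mlieBracket 𝓘(ℝ, E) X Y) p := mlieBracket_swap_apply
  have s2 : mlieBracket 𝓘(ℝ, E) Y (mlieBracket 𝓘(ℝ, E) X Z) p =
      -mlieBracket 𝓘(ℝ, E) Y (mlieBracket 𝓘(ℝ, E) Z X) p := by
    have : mlieBracket 𝓘(ℝ, E) X Z = (fun _ : K => (-1 : ℝ)) • mlieBracket 𝓘(ℝ, E) Z X := by
      ext q
      exact mlieBracket_swap_apply.trans (neg_one_smul ℝ (mlieBracket 𝓘(ℝ, E) Z X q)).symm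
    rw [this, mlieBracket_smul_right_apply Y mdifferentiableAt_const
      ((hZ.mlieBracket hX).diffAt p), mvfderiv_const]
    simp
  rw [s1, s2] at j
  rw [curvature, curvature, curvature, key hX hY hZ, key hY hZ hX, key hZ hX hY, j]
  abel

/-- The curvature operator is skew-symmetric. -/
theorem inner_curvature_swap {X Y Z W : VField E K} (hX : IsSmooth X) (hY : IsSmooth Y)
    (hZ : IsSmooth Z) (hW : IsSmooth W) (p : K) :
    ⟪curvature X Y Z p, W p⟫ = -⟪curvature X Y W p, Z p⟫ := by
  have hf : ∀ q, ContMDiffAt 𝓘(ℝ, E) 𝓘(ℝ, ℝ) ∞ (fun q => ⟪Z q, W q⟫) q := fun q =>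
    SmoothAt.inner (hZ q) (hW q)
  -- The second derivative A(B⟨Z,W⟩). Its mixed products are symmetric in `A` and `B`, so they drop
  -- out of the commutator, which equals [X,Y]⟨Z,W⟩.
  have second : ∀ {A B : VField E K}, IsSmooth A → IsSmooth B →
      mvfderiv 𝓘(ℝ, E) (fun q => mvfderiv 𝓘(ℝ, E) (fun q => ⟪Z q, W q⟫) q (B q)) p (A p) =
        ⟪leviCivita A (leviCivita B Z) p, W p⟫ + ⟪leviCivita B Z p, leviCivita A W p⟫
        + (⟪leviCivita A Z p, leviCivita B W p⟫ + ⟪Z p, leviCivita A (leviCivita B W) p⟫) := by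
    intro A B hA hB
    have e : (fun q => mvfderiv 𝓘(ℝ, E) (fun q => ⟪Z q, W q⟫) q (B q)) =
        (fun q => ⟪leviCivita B Z q, W q⟫) + fun q => ⟪Z q, leviCivita B W q⟫ := by
      ext q
      exact derivInner_eq_inner_leviCivita (hB.diffAt q) (hZ.diffAt q) (hW.diffAt q)
    rw [e, mvfderiv_add (((hB.leviCivita hZ).diffAt p).inner (hW.diffAt p))
      ((hZ.diffAt p).inner ((hB.leviCivita hW).diffAt p)),
      ← derivInner_eq_inner_leviCivita (hA.diffAt p) ((hB.leviCivita hZ).diffAt p) (hW.diffAt p),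
      ← derivInner_eq_inner_leviCivita (hA.diffAt p) (hZ.diffAt p) ((hB.leviCivita hW).diffAt p)]
    rfl
  have h1 := mvfderiv_mlieBracket (p := p) hX hY (.of_forall hf)
  rw [second hX hY, second hY hX] at h1
  have h2 : mvfderiv 𝓘(ℝ, E) (fun q => ⟪Z q, W q⟫) p (mlieBracket 𝓘(ℝ, E) X Y p) = _ :=
    derivInner_eq_inner_leviCivita ((hX.mlieBracket hY).diffAt p) (hZ.diffAt p) (hW.diffAt p)
  rw [h2] at h1
  simp only [curvature, inner_sub_left]
  simp only [real_inner_comm (Z p)]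
  rw [real_inner_comm (leviCivita X W p)] at h1
  linarith

section Kahler

variable {J : ∀ p : K, TangentSpace 𝓘(ℝ, E) p →ₗ[ℝ] TangentSpace 𝓘(ℝ, E) p}

/-- `J` is parallel, so it passes through each covariant derivative in the curvature. -/
theorem IsKahler.curvature_applyField (hJ : IsKahler J) {X Y Z : VField E K} (hX : IsSmooth X)
    (hY : IsSmooth Y) (hZ : IsSmooth Z) (p : K) :
    curvature X Y (applyField J Z) p = J p (curvature X Y Z p) := by
  have h : ∀ {A B : VField E K}, IsSmooth A → IsSmooth B →
      leviCivita A (applyField J B) = applyField J (leviCivita A B) := fun hA hB => by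
    ext q
    exact hJ.parallel _ _ hA hB q
  rw [curvature, h hY hZ, h hX hZ, h hX (hY.leviCivita hZ), h hY (hX.leviCivita hZ),
    h (hX.mlieBracket hY) hZ, curvature, map_sub, map_sub]
  rfl

/-- The smooth vector fields form an additive group. -/
def smoothFields : AddSubgroup (VField E K) where
  carrier := {X | IsSmooth X}
  add_mem' := IsSmooth.add
  zero_mem' := contMDiff_zeroSection ℝ (TangentSpace 𝓘(ℝ, E) (M := K))
  neg_mem' h := ContMDiff.neg_section h

theorem IsComplexSpaceForm.inner_curvature {v : ℝ} (hJ : IsComplexSpaceForm J v)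
    {X Y : VField E K} (hX : IsSmooth X) (hY : IsSmooth Y) (p : K) :
    ⟪curvature X Y Y p, X p⟫ = v / 4 * (⟪X p, X p⟫ * ⟪Y p, Y p⟫ - ⟪X p, Y p⟫ ^ 2
      + 3 * ⟪X p, J p (Y p)⟫ ^ 2) := by
  -- The polarization is run on the additive group of global smooth fields, with inner products
  -- taken at `p`. It uses only additivity of the curvature, so tensoriality of the curvature need
  -- not be established.
  let A := smoothFields (E := E) (K := K)
  let JA : A → A := fun X => ⟨applyField J X, hJ.smooth _ X.2⟩
  let R : A → A → A → A → ℝ := fun X Y Z W => ⟪curvature X.1 Y.1 Z.1 p, W.1 p⟫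
  have hR : IsKahlerCurvature JA R :=
    { J_add x y := Subtype.ext (funext fun q => map_add (J q) (x.1 q) (y.1 q))
      J_sq x := Subtype.ext (funext fun q => hJ.sq q (x.1 q))
      add x x' y z w := by
        change ⟪curvature (x.1 + x'.1) y.1 z.1 p, w.1 p⟫ = _
        rw [curvature_add_left x.2 x'.2 y.2 z.2, inner_add_left]
      swap x y z w := by
        change ⟪curvature x.1 y.1 z.1 p, w.1 p⟫ = _
        rw [curvature_swap x.2 y.2 z.2, inner_neg_left]
      swap' x y z w := inner_curvature_swap x.2 y.2 z.2 w.2 p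
      bianchi x y z w := by
        change ⟪curvature x.1 y.1 z.1 p, w.1 p⟫ + ⟪curvature y.1 z.1 x.1 p, w.1 p⟫ +
          ⟪curvature z.1 x.1 y.1 p, w.1 p⟫ = 0
        rw [← inner_add_left, ← inner_add_left, curvature_bianchi x.2 y.2 z.2, inner_zero_left]
      kahler x y z w := by
        change ⟪curvature x.1 y.1 (applyField J z.1) p, J p (w.1 p)⟫ = _
        rw [hJ.curvature_applyField x.2 y.2 z.2, hJ.hermitian] }
  exact hR.apply_of_const_holSectional (g := fun X Y => ⟪X.1 p, Y.1 p⟫) v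
    (fun x x' y => inner_add_left _ _ _) (fun x y => real_inner_comm _ _)
    (fun x y => hJ.hermitian p _ _) (fun x => hJ.holSectional x.1 x.2 p) ⟨X, hX⟩ ⟨Y, hY⟩

end Kahler

end

/-! ### Smoothness and involutivity of the vertical distribution -/

section

section Gradient

variable {E : Type*} [NormedAddCommGroup E] [NormedSpace ℝ E]
  {K : Type*} [TopologicalSpace K] [ChartedSpace E K]
  [FiniteDimensional ℝ E]
  [RiemannianBundle (fun p : K => TangentSpace 𝓘(ℝ, E) p)]

/-- The gradient of a function. -/
noncomputable def gradient (f : K → ℝ) : VField E K := fun q =>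
  haveI := FiniteDimensional.complete ℝ (TangentSpace 𝓘(ℝ, E) q)
  (InnerProductSpace.toDual ℝ (TangentSpace 𝓘(ℝ, E) q)).symm (mvfderiv 𝓘(ℝ, E) f q)

theorem inner_gradient (f : K → ℝ) (q : K) (v : TangentSpace 𝓘(ℝ, E) q) :
    ⟪gradient f q, v⟫ = mvfderiv 𝓘(ℝ, E) f q v :=
  haveI := FiniteDimensional.complete ℝ (TangentSpace 𝓘(ℝ, E) q)
  InnerProductSpace.toDual_symm_apply

variable [IsManifold 𝓘(ℝ, E) ∞ K]
  [IsContMDiffRiemannianBundle 𝓘(ℝ, E) ∞ E (fun p : K => TangentSpace 𝓘(ℝ, E) p)]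

theorem smoothAt_gradient {f : K → ℝ} {p : K} (hf : ContMDiffAt 𝓘(ℝ, E) 𝓘(ℝ, ℝ) ∞ f p) :
    SmoothAt (gradient (E := E) f) p := by
  refine smoothAt_of_forall_inner fun Z hZ => ?_
  have : (fun q => ⟪Z q, gradient (E := E) f q⟫) = fun q => mvfderiv 𝓘(ℝ, E) f q (Z q) := by
    ext q
    rw [real_inner_comm, inner_gradient]
  rw [this]
  exact SmoothAt.mvfderiv_apply hf hZ.self_of_nhds

end Gradient

variable {E : Type*} [NormedAddCommGroup E] [NormedSpace ℝ E]
  {K : Type*} [TopologicalSpace K] [ChartedSpace E K] [IsManifold 𝓘(ℝ, E) ∞ K]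
  {E' : Type*} [NormedAddCommGroup E'] [NormedSpace ℝ E']
  {L : Type*} [TopologicalSpace L] [ChartedSpace E' L] [IsManifold 𝓘(ℝ, E') ∞ L]
  {F : K → L}

omit [IsManifold 𝓘(ℝ, E) ∞ K] in
/-- Near each point, the vertical spaces of `F` are the common kernels of the differentials of
finitely many smooth functions, and these are independent if `F` is a submersion. -/
theorem exists_local_components [FiniteDimensional ℝ E']
    (hF : ContMDiff 𝓘(ℝ, E) 𝓘(ℝ, E') ∞ F) (p : K)
    (hs : Function.Surjective (mfderiv 𝓘(ℝ, E) 𝓘(ℝ, E') F p)) :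
    ∃ (n : ℕ) (g : Fin n → K → ℝ),
      (∀ᶠ q in 𝓝 p, ∀ k, ContMDiffAt 𝓘(ℝ, E) 𝓘(ℝ, ℝ) ∞ (g k) q) ∧
      (∀ᶠ q in 𝓝 p, ∀ v : TangentSpace 𝓘(ℝ, E) q, v ∈ vertical (E := E) (E' := E') F q ↔
        ∀ k, mvfderiv 𝓘(ℝ, E) (g k) q v = 0) ∧
      ∀ c : Fin n → ℝ, (∀ v, ∑ k, c k * mvfderiv 𝓘(ℝ, E) (g k) p v = 0) → c = 0 := by
  let b := Module.finBasis ℝ E'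
  let φ := extChartAt 𝓘(ℝ, E') (F p)
  -- The required functions are the coordinates of `F` in a chart of `L` around `F p`.
  let ℓ : Fin (Module.finrank ℝ E') → (E' →L[ℝ] ℝ) := fun k =>
    LinearMap.toContinuousLinearMap (b.coord k)
  have hsrc : ∀ᶠ q in 𝓝 p, F q ∈ (chartAt E' (F p)).source :=
    hF.continuous.continuousAt.eventually
      ((chartAt E' (F p)).open_source.mem_nhds (mem_chart_source E' (F p)))
  have hφ : ∀ y ∈ (chartAt E' (F p)).source, ContMDiffAt 𝓘(ℝ, E') 𝓘(ℝ, E') ∞ φ y := fun y hy =>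
    contMDiffAt_extChartAt' hy
  have hd : ∀ q, F q ∈ (chartAt E' (F p)).source → ∀ k, ∀ v : TangentSpace 𝓘(ℝ, E) q,
      mvfderiv 𝓘(ℝ, E) (fun x => ℓ k (φ (F x))) q v =
        ℓ k (mfderiv 𝓘(ℝ, E') 𝓘(ℝ, E') φ (F q) (mfderiv 𝓘(ℝ, E) 𝓘(ℝ, E') F q v)) := by
    intro q hq k v
    have h1 : HasMFDerivAt 𝓘(ℝ, E) 𝓘(ℝ, E') F q (mfderiv 𝓘(ℝ, E) 𝓘(ℝ, E') F q) :=
      (hF.mdifferentiableAt (by simp)).hasMFDerivAt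
    have h2 : HasMFDerivAt 𝓘(ℝ, E') 𝓘(ℝ, E') φ (F q) (mfderiv 𝓘(ℝ, E') 𝓘(ℝ, E') φ (F q)) :=
      ((hφ _ hq).mdifferentiableAt (by simp)).hasMFDerivAt
    have h3 : HasMFDerivAt 𝓘(ℝ, E') 𝓘(ℝ, ℝ) (ℓ k) (φ (F q)) (ℓ k) :=
      (ℓ k).hasMFDerivAt
    have h4 := (h3.comp q (h2.comp q h1)).mfderiv
    exact congrArg (fun T : E →L[ℝ] ℝ => T v) h4
  refine ⟨_, fun k x => ℓ k (φ (F x)), ?_, ?_, ?_⟩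
  · filter_upwards [hsrc] with q hq k
    exact (ℓ k).contDiff.contMDiff.contMDiffAt.comp q ((hφ _ hq).comp q hF.contMDiffAt)
  · filter_upwards [hsrc] with q hq v
    have hinv : (mfderiv 𝓘(ℝ, E') 𝓘(ℝ, E') φ (F q)).IsInvertible :=
      isInvertible_mfderiv_extChartAt (by simpa [φ] using hq)
    have hv : v ∈ vertical (E := E) (E' := E') F q ↔
        mfderiv 𝓘(ℝ, E) 𝓘(ℝ, E') F q v = 0 := LinearMap.mem_ker
    rw [hv]
    constructor
    · intro h k
      rw [hd q hq, h, map_zero]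
      exact map_zero (ℓ k)
    · intro h
      have h0 : mfderiv 𝓘(ℝ, E') 𝓘(ℝ, E') φ (F q) (mfderiv 𝓘(ℝ, E) 𝓘(ℝ, E') F q v) = 0 := by
        refine b.ext_elem fun k => ?_
        have := h k
        rw [hd q hq] at this
        refine this.trans ?_
        exact (map_zero (ℓ k)).symm
      refine hinv.injective ?_
      rw [h0, map_zero]
  · intro c hc
    have hq := hsrc.self_of_nhds
    have hinv : (mfderiv 𝓘(ℝ, E') 𝓘(ℝ, E') φ (F p)).IsInvertible :=
      isInvertible_mfderiv_extChartAt (mem_extChartAt_source (F p))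
    -- Surjectivity yields a `v` that is sent to the basis vector `b j`; testing the relation on it
    -- isolates `c j`.
    ext j
    obtain ⟨w, hw⟩ := hinv.surjective (b j)
    obtain ⟨v, hv⟩ := hs w
    have := hc v
    simp only [hd p hq, hv, hw] at this
    simpa [ℓ, Finsupp.single_apply] using this

variable [FiniteDimensional ℝ E]

/-- The bracket of vertical fields is vertical. -/
theorem IsVertical.mlieBracket_mem [FiniteDimensional ℝ E'] {U V : VField E K}
    (hF : ContMDiff 𝓘(ℝ, E) 𝓘(ℝ, E') ∞ F) {p : K}
    (hs : Function.Surjective (mfderiv 𝓘(ℝ, E) 𝓘(ℝ, E') F p))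
    (hU : IsVertical (E' := E') F U) (hV : IsVertical (E' := E') F V) :
    mlieBracket 𝓘(ℝ, E) U V p ∈ vertical (E' := E') F p := by
  obtain ⟨n, g, hg, hker, -⟩ := exists_local_components hF p hs
  refine (hker.self_of_nhds _).2 fun k => ?_
  -- A vertical field annihilates each `g k` near `p`, so the bracket, acting as a commutator,
  -- annihilates it at `p`.
  have h0 : ∀ W : VField E K, IsVertical (E' := E') F W →
      mvfderiv 𝓘(ℝ, E) (fun q => mvfderiv 𝓘(ℝ, E) (g k) q (W q)) p = 0 := by
    intro W hW
    have : (fun q => mvfderiv 𝓘(ℝ, E) (g k) q (W q)) =ᶠ[𝓝 p] fun _ => (0 : ℝ) := by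
      filter_upwards [hker] with q hq
      exact (hq _).1 (hW.mem q) k
    rw [mvfderiv_congr this, mvfderiv_const]
  rw [mvfderiv_mlieBracket hU.smooth hV.smooth (hg.mono fun q h => h k), h0 U hU, h0 V hV]
  simp

variable [RiemannianBundle (fun p : K => TangentSpace 𝓘(ℝ, E) p)]
  [IsContMDiffRiemannianBundle 𝓘(ℝ, E) ∞ E (fun p : K => TangentSpace 𝓘(ℝ, E) p)]
  [FiniteDimensional ℝ E']

/-- The horizontal part of a smooth field is smooth. -/
theorem smoothAt_hPart {X : VField E K} (hF : ContMDiff 𝓘(ℝ, E) 𝓘(ℝ, E') ∞ F) {p : K}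
    (hs : Function.Surjective (mfderiv 𝓘(ℝ, E) 𝓘(ℝ, E') F p)) (hX : SmoothAt X p) :
    SmoothAt (hPart (E' := E') F X) p := by
  obtain ⟨n, g, hg, hker, hli⟩ := exists_local_components hF p hs
  have hgrad : ∀ k, SmoothAt (gradient (E := E) (g k)) p := fun k =>
    smoothAt_gradient (hg.self_of_nhds k)
  -- The gradients of the `g k` span the horizontal space near `p`. They have the same inner
  -- products with `X` as with its horizontal part, so `smoothAt_of_inner` applies.
  have hspan : ∀ᶠ q in 𝓝 p, (vertical (E := E) (E' := E') F q)ᗮ =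
      Submodule.span ℝ (Set.range fun k => gradient (E := E) (g k) q) := by
    filter_upwards [hker] with q hq
    have : vertical (E := E) (E' := E') F q =
        (Submodule.span ℝ (Set.range fun k => gradient (E := E) (g k) q))ᗮ := by
      ext v
      rw [hq v, Submodule.mem_orthogonal]
      constructor
      · intro h u hu
        induction hu using Submodule.span_induction with
        | mem x hx => obtain ⟨k, rfl⟩ := hx; exact (inner_gradient _ _ _).trans (h k)
        | zero => exact inner_zero_left _
        | add x y _ _ hx hy => rw [inner_add_left, hx, hy, add_zero]
        | smul a x _ hx => rw [real_inner_smul_left, hx, mul_zero]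
      · intro h k
        rw [← inner_gradient]
        exact h _ (Submodule.subset_span ⟨k, rfl⟩)
    rw [this, Submodule.orthogonal_orthogonal]
  refine smoothAt_of_inner hgrad ?_ ?_ fun k => ?_
  · rw [Fintype.linearIndependent_iff]
    intro c hc
    refine congrFun (hli c fun v => ?_)
    have : ⟪∑ k, c k • gradient (g k) p, v⟫ = 0 := by rw [hc, inner_zero_left]
    rw [sum_inner] at this
    simpa only [real_inner_smul_left, inner_gradient] using this
  · filter_upwards [hspan] with q hq
    rw [← hq]
    exact Submodule.starProjection_apply_mem _ _
  · refine (SmoothAt.inner (hgrad k) hX).congr_of_eventuallyEq ?_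
    filter_upwards [hspan] with q hq
    have hm : gradient (g k) q ∈ (vertical (E := E) (E' := E') F q)ᗮ := by
      rw [hq]
      exact Submodule.subset_span ⟨k, rfl⟩
    rw [hPart, ← Submodule.inner_starProjection_left_eq_right,
      Submodule.starProjection_eq_self_iff.2 hm]

omit [IsManifold 𝓘(ℝ, E) ∞ K] [IsManifold 𝓘(ℝ, E') ∞ L] [FiniteDimensional ℝ E']
  [IsContMDiffRiemannianBundle 𝓘(ℝ, E) ∞ E (fun p : K => TangentSpace 𝓘(ℝ, E) p)] in
theorem vPart_add_hPart (X : VField E K) (p : K) :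
    vPart (E' := E') F X p + hPart (E' := E') F X p = X p :=
  Submodule.starProjection_add_starProjection_orthogonal _

theorem smoothAt_vPart {X : VField E K} (hF : ContMDiff 𝓘(ℝ, E) 𝓘(ℝ, E') ∞ F) {p : K}
    (hs : Function.Surjective (mfderiv 𝓘(ℝ, E) 𝓘(ℝ, E') F p)) (hX : SmoothAt X p) :
    SmoothAt (vPart (E' := E') F X) p := by
  have h : vPart (E' := E') F X = X - hPart (E' := E') F X := by
    ext q
    exact eq_sub_of_add_eq (vPart_add_hPart X q)
  rw [h]
  exact ContMDiffAt.sub_section hX (smoothAt_hPart hF hs hX)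

end

/-! ### Second fundamental form and Gauss equation of the fibers -/

section

/-- Multiplication by a bump function. The results on curvature require globally smooth fields,
while `FiberBundle.extend` is only known to be smooth near `p`. -/
theorem exists_isSmooth_eventuallyEq_extend {E : Type*} [NormedAddCommGroup E] [NormedSpace ℝ E]
    [FiniteDimensional ℝ E] {K : Type*} [TopologicalSpace K] [T2Space K] [ChartedSpace E K]
    [IsManifold 𝓘(ℝ, E) ∞ K] {p : K} (v : TangentSpace 𝓘(ℝ, E) p) :
    ∃ X : VField E K, IsSmooth X ∧ X =ᶠ[𝓝 p] (FiberBundle.extend E v : VField E K) := by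
  obtain ⟨s, hs, hv⟩ := FiberBundle.exists_contMDiffOn_extend (k := ∞) 𝓘(ℝ, E) E v
  obtain ⟨f, hf, -⟩ := (SmoothBumpFunction.nhds_basis_support (I := 𝓘(ℝ, E))
    (interior_mem_nhds.2 hs)).mem_iff.1 Filter.univ_mem
  refine ⟨(f : K → ℝ) • FiberBundle.extend E v, ?_, ?_⟩
  · exact ContMDiffOn.smul_section_of_tsupport f.contMDiff.contMDiffOn isOpen_interior hf
      (hv.mono interior_subset)
  · filter_upwards [f.eventuallyEq_one] with q hq
    change f q • (FiberBundle.extend E v : VField E K) q = _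
    rw [hq]
    exact one_smul ℝ _

variable {E : Type*} [NormedAddCommGroup E] [NormedSpace ℝ E]
  {K : Type*} [TopologicalSpace K] [ChartedSpace E K] [IsManifold 𝓘(ℝ, E) ∞ K]
  {E' : Type*} [NormedAddCommGroup E'] [NormedSpace ℝ E']
  {L : Type*} [TopologicalSpace L] [ChartedSpace E' L] [IsManifold 𝓘(ℝ, E') ∞ L]
  {F : K → L} [FiniteDimensional ℝ E]
  [RiemannianBundle (fun p : K => TangentSpace 𝓘(ℝ, E) p)]

section Projections

omit [IsManifold 𝓘(ℝ, E) ∞ K] [IsManifold 𝓘(ℝ, E') ∞ L]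

theorem vPart_mem (X : VField E K) (p : K) :
    vPart (E' := E') F X p ∈ vertical (E := E) (E' := E') F p :=
  Submodule.starProjection_apply_mem _ _

theorem hPart_mem (X : VField E K) (p : K) :
    hPart (E' := E') F X p ∈ (vertical (E := E) (E' := E') F p)ᗮ :=
  Submodule.starProjection_apply_mem _ _

theorem hPart_eq_zero_iff (X : VField E K) (p : K) :
    hPart (E' := E') F X p = 0 ↔ X p ∈ vertical (E := E) (E' := E') F p := by
  rw [hPart, Submodule.starProjection_apply_eq_zero_iff, Submodule.orthogonal_orthogonal]

theorem vPart_eq_self {X : VField E K} (h : ∀ p, X p ∈ vertical (E := E) (E' := E') F p) :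
    vPart (E' := E') F X = X :=
  funext fun p => Submodule.starProjection_eq_self_iff.2 (h p)

theorem hPart_eq_zero {X : VField E K} (h : ∀ p, X p ∈ vertical (E := E) (E' := E') F p) :
    hPart (E' := E') F X = 0 :=
  funext fun p => (hPart_eq_zero_iff X p).2 (h p)

theorem inner_vPart_left (X : VField E K) {p : K} {y : TangentSpace 𝓘(ℝ, E) p}
    (hy : y ∈ vertical (E := E) (E' := E') F p) : ⟪vPart (E' := E') F X p, y⟫ = ⟪X p, y⟫ := by
  rw [vPart, Submodule.inner_starProjection_left_eq_right, Submodule.starProjection_eq_self_iff.2 hy]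

theorem inner_hPart_right (X : VField E K) {p : K} {y : TangentSpace 𝓘(ℝ, E) p}
    (hy : y ∈ (vertical (E := E) (E' := E') F p)ᗮ) :
    ⟪y, hPart (E' := E') F X p⟫ = ⟪y, X p⟫ := by
  rw [hPart, ← Submodule.inner_starProjection_left_eq_right,
    Submodule.starProjection_eq_self_iff.2 hy]

theorem vPart_congr {X Y : VField E K} {p : K} (h : X =ᶠ[𝓝 p] Y) :
    vPart (E' := E') F X =ᶠ[𝓝 p] vPart (E' := E') F Y := by
  filter_upwards [h] with q hq
  rw [vPart, vPart, hq]

theorem hPart_congr {X Y : VField E K} {p : K} (h : X =ᶠ[𝓝 p] Y) :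
    hPart (E' := E') F X =ᶠ[𝓝 p] hPart (E' := E') F Y := by
  filter_upwards [h] with q hq
  rw [hPart, hPart, hq]

end Projections

omit [IsManifold 𝓘(ℝ, E') ∞ L] in
theorem vFrame_apply_self (p : K) (i) : vFrame (E' := E') F p i p =
    (stdOrthonormalBasis ℝ (vertical (E := E) (E' := E') F p) i : TangentSpace 𝓘(ℝ, E) p) := by
  rw [vFrame, vPart, FiberBundle.extend_apply_self]
  exact Submodule.starProjection_eq_self_iff.2 (Subtype.property _)

section Locality

omit [IsManifold 𝓘(ℝ, E') ∞ L]

theorem leviCivita_eventuallyEq {X X' Y Y' : VField E K} {p : K} (hX : X =ᶠ[𝓝 p] X')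
    (hY : Y =ᶠ[𝓝 p] Y') : leviCivita X Y =ᶠ[𝓝 p] leviCivita X' Y' := by
  filter_upwards [hX.eventuallyEq_nhds, hY.eventuallyEq_nhds] with q h1 h2
  exact leviCivita_congr h1 h2

theorem fiberConnection_congr {X X' Y Y' : VField E K} {p : K} (hX : X =ᶠ[𝓝 p] X')
    (hY : Y =ᶠ[𝓝 p] Y') :
    fiberConnection (E' := E') F X Y =ᶠ[𝓝 p] fiberConnection (E' := E') F X' Y' :=
  vPart_congr (leviCivita_eventuallyEq hX hY)

/-- Allows a frame field to be replaced by a global vertical field with the same germ. Derivatives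
are iterated, so equality at `p` alone would not suffice. -/
theorem fiberCurvature_congr {X X' Y Y' Z Z' : VField E K} {p : K} (hX : X =ᶠ[𝓝 p] X')
    (hY : Y =ᶠ[𝓝 p] Y') (hZ : Z =ᶠ[𝓝 p] Z') :
    fiberCurvature (E' := E') F X Y Z p = fiberCurvature (E' := E') F X' Y' Z' p := by
  rw [fiberCurvature, fiberCurvature,
    (fiberConnection_congr hX (fiberConnection_congr hY hZ)).eq_of_nhds,
    (fiberConnection_congr hY (fiberConnection_congr hX hZ)).eq_of_nhds,
    (fiberConnection_congr (hX.mlieBracket_vectorField hY) hZ).eq_of_nhds]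

theorem tensorT_congr {X X' Y Y' : VField E K} {p : K} (hX : X =ᶠ[𝓝 p] X')
    (hY : Y =ᶠ[𝓝 p] Y') : tensorT (E' := E') F X Y p = tensorT (E' := E') F X' Y' p := by
  rw [tensorT, tensorT,
    (hPart_congr (leviCivita_eventuallyEq (vPart_congr hX) (vPart_congr hY))).eq_of_nhds,
    (vPart_congr (leviCivita_eventuallyEq (vPart_congr hX) (hPart_congr hY))).eq_of_nhds]

end Locality

variable [IsContMDiffRiemannianBundle 𝓘(ℝ, E) ∞ E (fun p : K => TangentSpace 𝓘(ℝ, E) p)]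

omit [IsManifold 𝓘(ℝ, E') ∞ L] in
-- The horizontal part of `V` is the zero field, so the second term of `T` involves only ∇_U 0,
-- which vanishes by additivity.
theorem tensorT_eq_hPart {U V : VField E K} (hU : IsVertical (E' := E') F U)
    (hV : IsVertical (E' := E') F V) (p : K) :
    tensorT (E' := E') F U V p = hPart (E' := E') F (leviCivita U V) p := by
  have hz : IsSmooth (0 : VField E K) := (smoothFields (E := E) (K := K)).zero_mem
  have h0 : leviCivita U (0 : VField E K) p = 0 := by
    have h := leviCivita_add_right (hU.smooth.diffAt p) (hz.diffAt p) (hz.diffAt p)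
    rw [add_zero] at h
    exact left_eq_add.1 h
  rw [tensorT, vPart_eq_self hU.mem, vPart_eq_self hV.mem, hPart_eq_zero hV.mem, vPart, h0,
    map_zero, add_zero]

variable [FiniteDimensional ℝ E']

section Submersion

variable (hF : ContMDiff 𝓘(ℝ, E) 𝓘(ℝ, E') ∞ F)
  (hs : ∀ p, Function.Surjective (mfderiv 𝓘(ℝ, E) 𝓘(ℝ, E') F p))
include hF hs

theorem IsSmooth.vPart {X : VField E K} (hX : IsSmooth X) : IsSmooth (vPart (E' := E') F X) :=
  fun p => smoothAt_vPart hF (hs p) (hX p)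

theorem IsSmooth.hPart {X : VField E K} (hX : IsSmooth X) : IsSmooth (hPart (E' := E') F X) :=
  fun p => smoothAt_hPart hF (hs p) (hX p)

theorem exists_isVertical_eventuallyEq_vFrame [T2Space K] (p : K) (i) :
    ∃ V : VField E K, IsVertical (E' := E') F V ∧ vFrame (E' := E') F p i =ᶠ[𝓝 p] V := by
  obtain ⟨X, hX, hXe⟩ := exists_isSmooth_eventuallyEq_extend
    (stdOrthonormalBasis ℝ (vertical (E := E) (E' := E') F p) i : TangentSpace 𝓘(ℝ, E) p)
  exact ⟨_, ⟨hX.vPart hF hs, vPart_mem X⟩, (vPart_congr hXe).symm⟩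

/-- The second fundamental form of the fibers is symmetric. -/
theorem hPart_leviCivita_comm {U V : VField E K} (hU : IsVertical (E' := E') F U)
    (hV : IsVertical (E' := E') F V) (p : K) :
    CPSRM.hPart (E' := E') F (leviCivita U V) p = CPSRM.hPart (E' := E') F (leviCivita V U) p := by
  have h := (leviCivita_sub_leviCivita (hU.smooth.diffAt p) (hV.smooth.diffAt p)).symm ▸
    hU.mlieBracket_mem hF (hs p) hV
  rw [← sub_eq_zero, CPSRM.hPart, CPSRM.hPart, ← map_sub]
  rw [Submodule.starProjection_apply_eq_zero_iff, Submodule.orthogonal_orthogonal]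
  exact h

/-- Write 𝒱W = W - ℋW and differentiate ⟨ℋW,U⟩ = 0 along `A`: this moves the derivative from ℋW to
`U`. It is the only computation behind the Gauss equation. -/
theorem inner_vPart_leviCivita_vPart {A W U : VField E K} (hA : IsSmooth A) (hW : IsSmooth W)
    (hU : IsVertical (E' := E') F U) (p : K) :
    ⟪CPSRM.vPart (E' := E') F (leviCivita A (CPSRM.vPart (E' := E') F W)) p, U p⟫ =
      ⟪leviCivita A W p, U p⟫
        + ⟪CPSRM.hPart (E' := E') F W p, CPSRM.hPart (E' := E') F (leviCivita A U) p⟫ := by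
  have hWh := hW.hPart hF hs
  have hWv := hW.vPart hF hs
  have e1 : leviCivita A W p = leviCivita A (CPSRM.vPart (E' := E') F W) p
      + leviCivita A (CPSRM.hPart (E' := E') F W) p := by
    rw [← leviCivita_add_right (hA.diffAt p) (hWv.diffAt p) (hWh.diffAt p)]
    congr 1
    ext q
    exact (vPart_add_hPart W q).symm
  have e2 := derivInner_eq_inner_leviCivita (hA.diffAt p) (hWh.diffAt p) (hU.smooth.diffAt p)
  have e3 : derivInner A (CPSRM.hPart (E' := E') F W) U p = 0 := by
    have : (fun q => ⟪CPSRM.hPart (E' := E') F W q, U q⟫) = fun _ => (0 : ℝ) := by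
      ext q
      exact Submodule.inner_left_of_mem_orthogonal (hU.mem q) (hPart_mem W q)
    rw [derivInner_eq, this, mvfderiv_const]
    simp
  rw [inner_vPart_left _ (hU.mem p), inner_hPart_right _ (hPart_mem W p), e1, inner_add_left]
  linarith

/-- The Gauss equation of the fibers. -/
theorem inner_fiberCurvature {U V : VField E K} (hU : IsVertical (E' := E') F U)
    (hV : IsVertical (E' := E') F V) (p : K) :
    ⟪fiberCurvature (E' := E') F U V V p, U p⟫ =
      ⟪curvature U V V p, U p⟫
        + ⟪tensorT (E' := E') F U U p, tensorT (E' := E') F V V p⟫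
        - ⟪tensorT (E' := E') F U V p, tensorT (E' := E') F U V p⟫ := by
  rw [fiberCurvature, inner_sub_left, inner_sub_left]
  simp only [fiberConnection]
  rw [inner_vPart_leviCivita_vPart hF hs hU.smooth (hV.smooth.leviCivita hV.smooth) hU,
    inner_vPart_leviCivita_vPart hF hs hV.smooth (hU.smooth.leviCivita hV.smooth) hU,
    inner_vPart_left _ (hU.mem p), curvature, inner_sub_left, inner_sub_left,
    tensorT_eq_hPart hU hU, tensorT_eq_hPart hV hV, tensorT_eq_hPart hU hV,
    hPart_leviCivita_comm hF hs hV hU, real_inner_comm (CPSRM.hPart F (leviCivita U U) p)]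
  ring

/-- The fibers are totally geodesic if the second fundamental form vanishes on local frames. -/
theorem leviCivita_mem_vertical {U V : VField E K} (hU : IsVertical (E' := E') F U)
    (hV : IsVertical (E' := E') F V) {p : K} {ι : Type*} {W : ι → VField E K}
    (hW : ∀ i, IsVertical (E' := E') F (W i))
    (hspan : V p ∈ Submodule.span ℝ (Set.range fun i => W i p))
    (h : ∀ i, tensorT (E' := E') F U (W i) p = 0) :
    leviCivita U V p ∈ vertical (E := E) (E' := E') F p := by
  rw [← hPart_eq_zero_iff, hPart_leviCivita_comm hF hs hU hV, hPart_eq_zero_iff,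
    ← Submodule.orthogonal_orthogonal (vertical (E := E) (E' := E') F p),
    Submodule.mem_orthogonal']
  intro z hz
  have hZ := (smoothAt_extend z).diffAt
  -- By symmetry of the second fundamental form it is enough to treat ∇_V U. Its component along a
  -- horizontal `z` is linear in `V p`, so vanishing on a spanning set of values at `p` suffices.
  let ℓ := TensorialAt.mkHom (fun X : VField E K => koszul X U (FiberBundle.extend E z) p) p
    (tensorialAt_koszul_left (hU.smooth.diffAt p) hZ)
  have hℓ : ∀ X : VField E K, IsSmooth X → ℓ (X p) = ⟪leviCivita X U p, z⟫ := by
    intro X hX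
    have h1 := inner_leviCivita (hX.diffAt p) (hU.smooth.diffAt p) hZ
    rw [FiberBundle.extend_apply_self] at h1
    rw [h1]
    exact TensorialAt.mkHom_apply _ (hX.diffAt p)
  rw [← hℓ V hV.smooth]
  have hle : Submodule.span ℝ (Set.range fun i => W i p) ≤ LinearMap.ker ℓ.toLinearMap := by
    rw [Submodule.span_le]
    rintro _ ⟨i, rfl⟩
    have h2 := h i
    rw [tensorT_eq_hPart hU (hW i), hPart_leviCivita_comm hF hs hU (hW i),
      hPart_eq_zero_iff] at h2
    exact (hℓ _ (hW i).smooth).trans (Submodule.inner_right_of_mem_orthogonal h2 hz)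
  exact hle hspan

end Submersion

end

/-! ### Slant angle and the Ricci curvature of the fibers -/

section

/-- The projection of `x` to a subspace is determined by the angle between them. -/
theorem cos_angleToSubspace_sq_mul {V : Type*} [NormedAddCommGroup V] [InnerProductSpace ℝ V]
    [FiniteDimensional ℝ V] (x : V) (S : Submodule ℝ V) :
    Real.cos (angleToSubspace x S) ^ 2 * ⟪x, x⟫ =
      ⟪S.starProjection x, S.starProjection x⟫ := by
  have h : ⟪x, S.starProjection x⟫ = ⟪S.starProjection x, S.starProjection x⟫ := by
    rw [← Submodule.inner_starProjection_left_eq_right,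
      ← Submodule.inner_starProjection_left_eq_right,
      Submodule.starProjection_eq_self_iff.2 (Submodule.starProjection_apply_mem S x)]
  by_cases hP : S.starProjection x = 0
  -- The angle with the zero vector is π/2, so its cosine vanishes along with the projection.
  · rw [angleToSubspace, hP, angle_zero_right]
    simp
  have hx : x ≠ 0 := fun h => hP (by rw [h, map_zero])
  have hxn : ‖x‖ ≠ 0 := norm_ne_zero_iff.2 hx
  have hPn : ‖S.starProjection x‖ ≠ 0 := norm_ne_zero_iff.2 hP
  rw [angleToSubspace, cos_angle, h, real_inner_self_eq_norm_sq, real_inner_self_eq_norm_sq]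
  field_simp

theorem sum_inner_sq_eq {V : Type*} [NormedAddCommGroup V] [InnerProductSpace ℝ V]
    [FiniteDimensional ℝ V] (S : Submodule ℝ V) {ι : Type*} [Fintype ι]
    (b : OrthonormalBasis ι ℝ S) (x : V) :
    ∑ i, ⟪x, (b i : V)⟫ ^ 2 = ⟪S.starProjection x, S.starProjection x⟫ := by
  have h := b.sum_sq_norm_inner_left (S.orthogonalProjectionOnto x)
  have e : ∀ i, ⟪x, (b i : V)⟫ = ⟪S.orthogonalProjectionOnto x, b i⟫ := fun i => by
    rw [Submodule.coe_inner, ← Submodule.starProjection_apply,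
      Submodule.inner_starProjection_left_eq_right,
      Submodule.starProjection_eq_self_iff.2 (b i).2]
  simp only [e, Submodule.starProjection_apply, real_inner_self_eq_norm_sq]
  simpa using h

variable {E : Type*} [NormedAddCommGroup E] [NormedSpace ℝ E] [FiniteDimensional ℝ E]
  {K : Type*} [TopologicalSpace K] [T2Space K] [ChartedSpace E K] [IsManifold 𝓘(ℝ, E) ∞ K]
  [RiemannianBundle (fun p : K => TangentSpace 𝓘(ℝ, E) p)]
  [IsContMDiffRiemannianBundle 𝓘(ℝ, E) ∞ E (fun p : K => TangentSpace 𝓘(ℝ, E) p)]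
  {E' : Type*} [NormedAddCommGroup E'] [NormedSpace ℝ E'] [FiniteDimensional ℝ E']
  {L : Type*} [TopologicalSpace L] [ChartedSpace E' L] [IsManifold 𝓘(ℝ, E') ∞ L]
  [RiemannianBundle (fun q : L => TangentSpace 𝓘(ℝ, E') q)]
  {J : ∀ p : K, TangentSpace 𝓘(ℝ, E) p →ₗ[ℝ] TangentSpace 𝓘(ℝ, E) p} {v : ℝ}
  {F : K → L} {θ : K → ℝ}

omit [T2Space K] [IsManifold 𝓘(ℝ, E) ∞ K]
  [RiemannianBundle (fun p : K => TangentSpace 𝓘(ℝ, E) p)]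
  [IsContMDiffRiemannianBundle 𝓘(ℝ, E) ∞ E (fun p : K => TangentSpace 𝓘(ℝ, E) p)]
  [IsManifold 𝓘(ℝ, E') ∞ L] [FiniteDimensional ℝ E] in
theorem surjective_mfderiv_of_rangeSpace {p : K}
    (h : (rangeSpace (E := E) (E' := E') F p)ᗮ = ⊥) :
    Function.Surjective (mfderiv 𝓘(ℝ, E) 𝓘(ℝ, E') F p) :=
  LinearMap.range_eq_top.1 ((Submodule.orthogonal_eq_bot_iff).1 h)

omit [T2Space K] [IsContMDiffRiemannianBundle 𝓘(ℝ, E) ∞ E (fun p : K => TangentSpace 𝓘(ℝ, E) p)]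
  [FiniteDimensional ℝ E'] [IsManifold 𝓘(ℝ, E') ∞ L] in
-- `J` is skew, so up to sign the summands are the components of J u in a vertical orthonormal
-- basis; their squares add up to the squared length of its vertical projection.
theorem sum_inner_J_sq (hJ : IsKahler J) (hF : IsCPSRM (E' := E') J F θ) {p : K}
    {u : TangentSpace 𝓘(ℝ, E) p} (hu : u ∈ vertical (E := E) (E' := E') F p) {ι : Type*} [Fintype ι]
    (b : OrthonormalBasis ι ℝ (vertical (E := E) (E' := E') F p)) :
    ∑ i, ⟪u, J p (b i)⟫ ^ 2 = Real.cos (θ p) ^ 2 * ⟪u, u⟫ := by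
  have e : ∀ i, ⟪u, J p (b i)⟫ ^ 2 = ⟪J p u, (b i : TangentSpace 𝓘(ℝ, E) p)⟫ ^ 2 := fun i => by
    rw [← hJ.hermitian p u, hJ.sq, inner_neg_right, neg_sq]
  simp only [e]
  rw [sum_inner_sq_eq]
  by_cases h0 : u = 0
  · simp [h0]
  · rw [← cos_angleToSubspace_sq_mul, hF.slant p u hu h0, hJ.hermitian]

/-- The Ricci curvature of the fibers: the difference of the two sides of the inequality is the
sum of the squared norms of `T_U E_i`. -/
theorem fiberRicci_eq (hK : IsComplexSpaceForm J v) (hF : IsCPSRM (E' := E') J F θ)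
    (hs : ∀ p, Function.Surjective (mfderiv 𝓘(ℝ, E) 𝓘(ℝ, E') F p)) {r : ℕ} {p : K}
    (hr : Module.finrank ℝ (vertical (E := E) (E' := E') F p) = 2 * r) {U : VField E K}
    (hU : IsVertical (E' := E') F U) :
    fiberRicci (E' := E') F U p =
      v / 4 * (2 * r - 1 + 3 * Real.cos (θ p) ^ 2) * ⟪U p, U p⟫
        + 2 * r * ⟪tensorT (E' := E') F U U p, meanCurvature (E' := E') F p⟫
        - ∑ i, ‖tensorT (E' := E') F U (vFrame (E' := E') F p i) p‖ ^ 2 := by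
  let b := stdOrthonormalBasis ℝ (vertical (E := E) (E' := E') F p)
  have hterm : ∀ i, ⟪fiberCurvature (E' := E') F U (vFrame (E' := E') F p i)
      (vFrame (E' := E') F p i) p, U p⟫ =
      v / 4 * (⟪U p, U p⟫ - ⟪U p, (b i : TangentSpace 𝓘(ℝ, E) p)⟫ ^ 2
        + 3 * ⟪U p, J p (b i)⟫ ^ 2)
      + ⟪tensorT (E' := E') F U U p,
          tensorT (E' := E') F (vFrame (E' := E') F p i) (vFrame (E' := E') F p i) p⟫
      - ‖tensorT (E' := E') F U (vFrame (E' := E') F p i) p‖ ^ 2 := by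
    intro i
    obtain ⟨V, hV, hVe⟩ := exists_isVertical_eventuallyEq_vFrame hF.smooth hs p i
    have hVp : V p = b i := by rw [← hVe.eq_of_nhds, vFrame_apply_self]
    have hn : ⟪V p, V p⟫ = 1 := by
      rw [hVp, ← Submodule.coe_inner, real_inner_self_eq_norm_sq, b.norm_eq_one, one_pow]
    rw [fiberCurvature_congr (.refl _ U) hVe hVe, tensorT_congr hVe hVe, tensorT_congr (.refl _ U) hVe,
      inner_fiberCurvature hF.smooth hs hU hV, hK.inner_curvature hU.smooth hV.smooth, hn, hVp,
      mul_one, real_inner_self_eq_norm_sq (tensorT F U V p)]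
  have hH : (2 * r : ℝ) * ⟪tensorT (E' := E') F U U p, meanCurvature (E' := E') F p⟫ =
      ∑ i, ⟪tensorT (E' := E') F U U p,
        tensorT (E' := E') F (vFrame (E' := E') F p i) (vFrame (E' := E') F p i) p⟫ := by
    rw [meanCurvature, real_inner_smul_right, inner_sum]
    -- For zero-dimensional fibers the factor in `meanCurvature` is 0⁻¹ and does not cancel, but the
    -- sum is empty.
    by_cases h0 : Module.finrank ℝ (vertical (E := E) (E' := E') F p) = 0
    · have : IsEmpty (Fin (Module.finrank ℝ (vertical (E := E) (E' := E') F p))) := by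
        rw [h0]; infer_instance
      simp
    · have h1 : (2 * r : ℝ) = Module.finrank ℝ (vertical (E := E) (E' := E') F p) := by
        rw [hr]; push_cast; ring
      rw [h1, mul_inv_cancel_left₀ (by exact_mod_cast h0)]
  have hcard : ∑ _i : Fin (Module.finrank ℝ (vertical (E := E) (E' := E') F p)), ⟪U p, U p⟫ =
      2 * r * ⟪U p, U p⟫ := by
    rw [Finset.sum_const, Finset.card_univ, Fintype.card_fin, hr, nsmul_eq_mul]
    push_cast
    ring
  have hsq : ∑ i, ⟪U p, (b i : TangentSpace 𝓘(ℝ, E) p)⟫ ^ 2 = ⟪U p, U p⟫ := by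
    rw [sum_inner_sq_eq, Submodule.starProjection_eq_self_iff.2 (hU.mem p)]
  have hJ := sum_inner_J_sq hK.toIsKahler hF (hU.mem p) b
  rw [fiberRicci, Finset.sum_congr rfl fun i _ => hterm i, Finset.sum_sub_distrib,
    Finset.sum_add_distrib, ← Finset.mul_sum, Finset.sum_add_distrib, Finset.sum_sub_distrib,
    ← Finset.mul_sum, hcard, hsq, hJ, hH]
  ring

end

end CPSRM

/-! ### The inequality and its equality case -/

theorem theorem3p6
    {E : Type*} [NormedAddCommGroup E] [NormedSpace ℝ E] [FiniteDimensional ℝ E]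
    {K : Type*} [TopologicalSpace K] [T2Space K] [ChartedSpace E K] [IsManifold 𝓘(ℝ, E) ∞ K]
    [RiemannianBundle (fun p : K => TangentSpace 𝓘(ℝ, E) p)]
    [IsContMDiffRiemannianBundle 𝓘(ℝ, E) ∞ E (fun p : K => TangentSpace 𝓘(ℝ, E) p)]
    {E' : Type*} [NormedAddCommGroup E'] [NormedSpace ℝ E'] [FiniteDimensional ℝ E']
    {L : Type*} [TopologicalSpace L] [T2Space L] [ChartedSpace E' L] [IsManifold 𝓘(ℝ, E') ∞ L]
    [RiemannianBundle (fun q : L => TangentSpace 𝓘(ℝ, E') q)]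
    [IsContMDiffRiemannianBundle 𝓘(ℝ, E') ∞ E' (fun q : L => TangentSpace 𝓘(ℝ, E') q)]
    (J : ∀ p : K, TangentSpace 𝓘(ℝ, E) p →ₗ[ℝ] TangentSpace 𝓘(ℝ, E) p) (v : ℝ)
    (hK : CPSRM.IsComplexSpaceForm J v)
    (F : K → L) (θ : K → ℝ) (hF : CPSRM.IsCPSRM (E' := E') J F θ)
    (hrange : ∀ p : K, (CPSRM.rangeSpace (E := E) (E' := E') F p)ᗮ = ⊥)
    (r : ℕ) (hr : ∀ p : K, Module.finrank ℝ (CPSRM.vertical (E := E) (E' := E') F p) = 2 * r) :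
    (∀ U : CPSRM.VField E K, CPSRM.IsVertical (E' := E') F U → ∀ p : K,
      CPSRM.fiberRicci (E' := E') F U p ≤
        v / 4 * (2 * r - 1 + 3 * Real.cos (θ p) ^ 2) * ⟪U p, U p⟫
          + 2 * r * ⟪CPSRM.tensorT (E' := E') F U U p, CPSRM.meanCurvature (E' := E') F p⟫) ∧
    ((∀ U : CPSRM.VField E K, CPSRM.IsVertical (E' := E') F U → ∀ p : K,
      CPSRM.fiberRicci (E' := E') F U p =
        v / 4 * (2 * r - 1 + 3 * Real.cos (θ p) ^ 2) * ⟪U p, U p⟫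
          + 2 * r * ⟪CPSRM.tensorT (E' := E') F U U p, CPSRM.meanCurvature (E' := E') F p⟫) ↔
      CPSRM.FibersTotallyGeodesic (E := E) (E' := E') F) := by
  have hs : ∀ p, Function.Surjective (mfderiv 𝓘(ℝ, E) 𝓘(ℝ, E') F p) := fun p =>
    CPSRM.surjective_mfderiv_of_rangeSpace (hrange p)
  have hric := fun (U : CPSRM.VField E K) (hU : CPSRM.IsVertical (E' := E') F U) (p : K) =>
    CPSRM.fiberRicci_eq hK hF hs (hr p) hU
  refine ⟨fun U hU p => ?_, fun h U V hU hV p => ?_, fun h U hU p => ?_⟩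
  · rw [hric U hU p]
    exact sub_le_self _ (Finset.sum_nonneg fun i _ => sq_nonneg _)
  -- Equality forces a sum of squares to vanish, hence T_U E_i = 0 at `p` for each `i`; the E_i span
  -- the vertical space there.
  · have h0 := h U hU p
    rw [hric U hU p, sub_eq_self, Finset.sum_eq_zero_iff_of_nonneg fun i _ => sq_nonneg _] at h0
    choose W hW hWe using CPSRM.exists_isVertical_eventuallyEq_vFrame hF.smooth hs p
    refine CPSRM.leviCivita_mem_vertical hF.smooth hs hU hV hW ?_ fun i => ?_
    · let b := stdOrthonormalBasis ℝ (CPSRM.vertical (E := E) (E' := E') F p)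
      have hb := congrArg Subtype.val (b.sum_repr ⟨V p, hV.mem p⟩)
      rw [AddSubmonoidClass.coe_finsetSum] at hb
      change _ = V p at hb
      rw [← hb]
      refine Submodule.sum_mem _ fun i _ => Submodule.smul_mem _ _ (Submodule.subset_span ⟨i, ?_⟩)
      exact (hWe i).eq_of_nhds.symm.trans (CPSRM.vFrame_apply_self p i)
    · rw [← CPSRM.tensorT_congr (.refl _ U) (hWe i)]
      simpa using h0 i (Finset.mem_univ i)
  · rw [hric U hU p, sub_eq_self]
    refine Finset.sum_eq_zero fun i _ => ?_
    obtain ⟨W, hW, hWe⟩ := CPSRM.exists_isVertical_eventuallyEq_vFrame hF.smooth hs p i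
    rw [CPSRM.tensorT_congr (.refl _ U) hWe, CPSRM.tensorT_eq_hPart hU hW,
      (CPSRM.hPart_eq_zero_iff _ p).2 (h U W hU hW p)]
    simp
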